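/- Let $M$ be a smooth manifold. A Born structure on $M$ is a triple $(g,h,\omega)$ of two pseudo-Riemannian metrics $g,h$ (of arbitrary signature) and a non-degenerate 2-form $\omega$ such that the endomorphism fields $A,B,J$ of $TM$ determined by $g(A\cdot,\cdot)=\omega$, $g(B\cdot,\cdot)=h$, $\omega(-J\cdot,\cdot)=h$ satisfy $A^2=B^2=-J^2=\mathrm{Id}$. It is integrable if $d\omega=0$ and the Nijenhuis tensors $N_T(X,Y)=[TX,TY]+T^2[X,Y]-T[TX,Y]-T[X,TY]$ of at least two of $T=A,B,J$ vanish identically. Let $L_\pm$ be the $(\pm1)$-eigenbundles of $A$. The Künneth connection $\nabla^K$ is the affine connection that preserves $L_+$ and $L_-$, satisfies $\nabla^K\omega=0$, and whose torsion $T^K$ satisfies $T^K(X,Y)=0$ whenever one of $X,Y$ lies in $L_+$ and the other in $L_-$. The Born connection $\nabla^B$ is the affine connection with $\nabla^B g=\nabla^B h=\nabla^B\omega=0$ and vanishing generalized torsion, i.e. for all vector fields $X,Y,Z$ $$g(\nabla^B_XY-\nabla^B_YX,Z)+g(\nabla^B_ZX,Y)=g(\nabla^c_XY-\nabla^c_YX,Z)+g(\nabla^c_ZX,Y),$$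 where $\nabla^c_XY=\frac12(\nabla^g_XY+A\nabla^g_X(AY))$ and $\nabla^g$ is the Levi-Civita connection of $g$. **Proposition.** Let $(g,h,\omega)$ be an integrable Born structure. Then $\nabla^K$ and $\nabla^B$ exist, and the torsion tensor $T^B$ of $\nabla^B$ has the following properties. 1. $T^B(X,Y)=0$ if $X$ and $Y$ lie in the same eigenbundle of $B$. 2. If $BX=X$ and $BY=-Y$, then $$T^B(X,Y)=-\tfrac12\left(\nabla^K_XY+B\nabla^K_XY\right)+\tfrac12\left(\nabla^K_YX-B\nabla^K_YX\right)=-\pi_+(\nabla^K_XY)+\pi_-(\nabla^K_YX),$$ where $\pi_\pm$ are the projections to the $(\pm1)$-eigenbundles of $B$. 3. $T^B$ vanishes identically if and only if $\nabla^K$ commutes with $B$, i.e. $\nabla^K_X(BY)=B\nabla^K_XY$ for all $X,Y$. -/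

import Mathlib

open scoped Manifold ContDiff
open Bundle VectorField

noncomputable section

namespace BornGeometry

/-! ## Linear algebra: the projections to the eigenspaces of an involution -/

section LinearAlgebra

variable {V : Type*} [AddCommGroup V] [Module ℝ V]

/-- The `1`- and the `-1`-eigenspace of a linear involution are complementary. -/
theorem isCompl_eigenspaces (T : Module.End ℝ V) (hT : ∀ u, T (T u) = u) :
    IsCompl (T.eigenspace 1) (T.eigenspace (-1)) := by
  constructor
  · rw [Submodule.disjoint_def]
    intro u h₁ h₂
    rw [Module.End.mem_eigenspace_iff] at h₁ h₂
    have h : u = -u := by simpa [h₁] using h₂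
    have h' : (2 : ℝ) • u = 0 := by rw [two_smul]; nth_rewrite 2 [h]; simp
    simpa using h'
  · rw [codisjoint_iff, Submodule.eq_top_iff']
    intro u
    rw [Submodule.mem_sup]
    refine ⟨(1 / 2 : ℝ) • (u + T u), ?_, (1 / 2 : ℝ) • (u - T u), ?_, by module⟩ <;>
    · rw [Module.End.mem_eigenspace_iff]
      simp only [map_smul, map_add, map_sub, hT]
      module

/-- A non-degenerate bilinear form on a finite-dimensional space is inverted by
`ContinuousLinearMap.inverse`. -/
theorem apply_inverse_of_nondegenerate {E : Type*} [NormedAddCommGroup E] [NormedSpace ℝ E]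
    [FiniteDimensional ℝ E] (a : E →L[ℝ] E →L[ℝ] ℝ) (ha : ∀ u, (∀ v, a u v = 0) → u = 0)
    (l : E →L[ℝ] ℝ) : a (a.inverse l) = l := by
  have inj : Function.Injective a :=
    (injective_iff_map_eq_zero a).2 fun w hw ↦ ha w fun v ↦ by simp [hw]
  have dim : Module.finrank ℝ E = Module.finrank ℝ (E →L[ℝ] ℝ) := by
    rw [← (LinearMap.toContinuousLinearMap (𝕜 := ℝ) (E := E) (F' := ℝ)).finrank_eq]
    exact (Subspace.dual_finrank_eq (K := ℝ) (V := E)).symm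
  let e : E ≃L[ℝ] (E →L[ℝ] ℝ) :=
    (LinearEquiv.ofInjectiveOfFinrankEq a.toLinearMap inj dim).toContinuousLinearEquiv
  have he : (e : E →L[ℝ] E →L[ℝ] ℝ) = a := by ext u v; rfl
  rw [← he, ContinuousLinearMap.inverse_equiv]
  exact e.apply_symm_apply l

end LinearAlgebra

variable {E : Type*} [NormedAddCommGroup E] [NormedSpace ℝ E]
  {M : Type*} [TopologicalSpace M] [ChartedSpace E M] [IsManifold 𝓘(ℝ, E) ∞ M]

/-! ## Tensor fields and recursion operators -/

section Tensors

variable (E M)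

/-- Vector fields on `M`. Differentiability is imposed where it is needed: `MDiffAt (T% X) x`
says that `X` is differentiable at `x`. -/
abbrev VecField := Π x : M, TangentSpace 𝓘(ℝ, E) x

/-- Fields of endomorphisms of the tangent bundle. -/
abbrev EndField := Π x : M, TangentSpace 𝓘(ℝ, E) x →L[ℝ] TangentSpace 𝓘(ℝ, E) x

/-- Fields of bilinear forms on the tangent bundle. -/
abbrev FormField := Π x : M, TangentSpace 𝓘(ℝ, E) x →L[ℝ] TangentSpace 𝓘(ℝ, E) x →L[ℝ] ℝ

/-- Distributions on `M`: a linear subspace of every tangent space. -/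
abbrev Distribution := Π x : M, Submodule ℝ (TangentSpace 𝓘(ℝ, E) x)

/-- Affine connections on `M`, i.e. covariant derivatives on the tangent bundle. Mathlib writes
`cov Y x v` for the derivative of the vector field `Y` at `x` in the direction `v`. -/
abbrev AffineConnection :=
  CovariantDerivative 𝓘(ℝ, E) E (TangentSpace 𝓘(ℝ, E) : M → Type _)

end Tensors

/-- The vector field `T X`. -/
def EndField.app (T : EndField E M) (X : VecField E M) : VecField E M := fun x ↦ T x (X x)

/-- The function `b(X, Y)`. -/
def FormField.app (b : FormField E M) (X Y : VecField E M) : M → ℝ := fun x ↦ b x (X x) (Y x)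

namespace FormField

/-- The field of bilinear forms `b` is smooth. -/
def IsSmooth (b : FormField E M) : Prop :=
  ContMDiff 𝓘(ℝ, E) (𝓘(ℝ, E).prod 𝓘(ℝ, E →L[ℝ] E →L[ℝ] ℝ)) ∞
    (fun x ↦ TotalSpace.mk' (E →L[ℝ] E →L[ℝ] ℝ) (E := fun x : M ↦
      TangentSpace 𝓘(ℝ, E) x →L[ℝ] TangentSpace 𝓘(ℝ, E) x →L[ℝ] ℝ) x (b x))

/-- The form `b` is non-degenerate at every point. -/
def IsNondegenerate (b : FormField E M) : Prop := ∀ x u, (∀ v, b x u v = 0) → u = 0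

/-- A pseudo-Riemannian metric: smooth, symmetric and non-degenerate (of any signature). -/
structure IsPseudoRiemannian (b : FormField E M) : Prop where
  smooth : b.IsSmooth
  symm : ∀ x u v, b x u v = b x v u
  nondegenerate : b.IsNondegenerate

/-- A non-degenerate 2-form: smooth, skew-symmetric and non-degenerate. -/
structure IsNondegenerateTwoForm (b : FormField E M) : Prop where
  smooth : b.IsSmooth
  skew : ∀ x u v, b x u v = -b x v u
  nondegenerate : b.IsNondegenerate

/-- The exterior derivative of a 2-form, evaluated on vector fields:
`dΩ(X,Y,Z) = X Ω(Y,Z) + Y Ω(Z,X) + Z Ω(X,Y) - Ω([X,Y],Z) - Ω([Y,Z],X) - Ω([Z,X],Y)`. -/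
def extDeriv (b : FormField E M) (X Y Z : VecField E M) (x : M) : ℝ :=
  d% (b.app Y Z) x (X x) + d% (b.app Z X) x (Y x) + d% (b.app X Y) x (Z x)
    - b x (mlieBracket 𝓘(ℝ, E) X Y x) (Z x) - b x (mlieBracket 𝓘(ℝ, E) Y Z x) (X x)
    - b x (mlieBracket 𝓘(ℝ, E) Z X x) (Y x)

/-- The 2-form `b` is closed. -/
def IsClosed (b : FormField E M) : Prop :=
  ∀ (x : M) (X Y Z : VecField E M), MDiffAt (T% X) x → MDiffAt (T% Y) x → MDiffAt (T% Z) x →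
    b.extDeriv X Y Z x = 0

end FormField

/-- The recursion operator from `a` to `b`, i.e. the field of endomorphisms `T` with
`a (T u, v) = b (u, v)`; see `recursionOperator_spec` and `recursionOperator_unique`. -/
def recursionOperator (a b : FormField E M) : EndField E M :=
  fun x ↦ (a x).inverse ∘L b x

theorem recursionOperator_spec [FiniteDimensional ℝ E] {a : FormField E M}
    (ha : a.IsNondegenerate) (b : FormField E M) (x : M) (u v : TangentSpace 𝓘(ℝ, E) x) :
    a x (recursionOperator a b x u) v = b x u v := by
  have key := apply_inverse_of_nondegenerate (E := E) (a x) (ha x) (b x u)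
  exact congrArg (fun l : E →L[ℝ] ℝ ↦ l v) key

theorem recursionOperator_unique [FiniteDimensional ℝ E] {a : FormField E M}
    (ha : a.IsNondegenerate) (b : FormField E M) (T : EndField E M)
    (hT : ∀ x u v, a x (T x u) v = b x u v) : T = recursionOperator a b := by
  ext x u
  refine sub_eq_zero.1 (ha x _ fun v ↦ ?_)
  simp [hT, recursionOperator_spec ha]

namespace EndField

/-- The Nijenhuis tensor `N_T(X,Y) = [TX,TY] + T²[X,Y] - T[TX,Y] - T[X,TY]`. -/
def nijenhuis (T : EndField E M) (X Y : VecField E M) (x : M) : TangentSpace 𝓘(ℝ, E) x :=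
  mlieBracket 𝓘(ℝ, E) (T.app X) (T.app Y) x + T x (T x (mlieBracket 𝓘(ℝ, E) X Y x))
    - T x (mlieBracket 𝓘(ℝ, E) (T.app X) Y x) - T x (mlieBracket 𝓘(ℝ, E) X (T.app Y) x)

/-- A field of endomorphisms is integrable if its Nijenhuis tensor vanishes. -/
def IsIntegrable (T : EndField E M) : Prop :=
  ∀ (x : M) (X Y : VecField E M), MDiffAt (T% X) x → MDiffAt (T% Y) x → T.nijenhuis X Y x = 0

/-- The eigenbundle of `T` for the eigenvalue `c`. -/
def eigenbundle (T : EndField E M) (c : ℝ) : Distribution E M :=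
  fun x ↦ Module.End.eigenspace (T x).toLinearMap c

end EndField

/-! ## Born structures -/

variable (E M) in
/-- A Born structure `(g, h, ω)` (with `ω` written as `Ω`): two pseudo-Riemannian metrics and a non-degenerate 2-form such
that the recursion operators `A` from `g` to `Ω`, `B` from `g` to `h` and `-J` from `Ω` to `h`
satisfy `A² = B² = -J² = Id`. -/
structure BornStructure where
  g : FormField E M
  h : FormField E M
  Ω : FormField E M
  isPseudoRiemannian_g : g.IsPseudoRiemannian
  isPseudoRiemannian_h : h.IsPseudoRiemannian
  isNondegenerateTwoForm_Ω : Ω.IsNondegenerateTwoForm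
  A_sq : ∀ x u, recursionOperator g Ω x (recursionOperator g Ω x u) = u
  B_sq : ∀ x u, recursionOperator g h x (recursionOperator g h x u) = u
  J_sq : ∀ x u, (-recursionOperator Ω h x) ((-recursionOperator Ω h x) u) = -u

namespace BornStructure

variable (S : BornStructure E M)

/-- The recursion operator `A` from `g` to `Ω`. -/
def A : EndField E M := recursionOperator S.g S.Ω

/-- The recursion operator `B` from `g` to `h`. -/
def B : EndField E M := recursionOperator S.g S.h

/-- The endomorphism field `J`, where `-J` is the recursion operator from `Ω` to `h`. -/
def J : EndField E M := fun x ↦ -recursionOperator S.Ω S.h x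

/-- The `ε`-eigenbundle `L_ε` of `A`, for `ε = 1` or `ε = -1`. -/
def L (ε : ℝ) : Distribution E M := S.A.eigenbundle ε

/-- A Born structure is integrable if `Ω` is closed and at least two of the three recursion
operators are integrable. -/
def IsIntegrable : Prop :=
  S.Ω.IsClosed ∧
    ((S.A.IsIntegrable ∧ S.B.IsIntegrable) ∨ (S.A.IsIntegrable ∧ S.J.IsIntegrable) ∨
      (S.B.IsIntegrable ∧ S.J.IsIntegrable))

/-- The two eigenbundles of `B` are complementary. -/
theorem isCompl_eigenbundles_B (x : M) :
    IsCompl (S.B.eigenbundle 1 x) (S.B.eigenbundle (-1) x) :=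
  isCompl_eigenspaces (S.B x).toLinearMap (S.B_sq x)

/-- The projection `π₊` to the `1`-eigenbundle of `B` along the `-1`-eigenbundle. -/
def πPlus (x : M) : TangentSpace 𝓘(ℝ, E) x →ₗ[ℝ] TangentSpace 𝓘(ℝ, E) x :=
  Submodule.projection _ _ (S.isCompl_eigenbundles_B x)

/-- The projection `π₋` to the `-1`-eigenbundle of `B` along the `1`-eigenbundle. -/
def πMinus (x : M) : TangentSpace 𝓘(ℝ, E) x →ₗ[ℝ] TangentSpace 𝓘(ℝ, E) x :=
  Submodule.projection _ _ (S.isCompl_eigenbundles_B x).symm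

end BornStructure

/-! ## Connections -/

section Connections

/-- The form `b` is parallel for `D`: `v b(Y,Z) = b(D_v Y, Z) + b(Y, D_v Z)`. -/
def Preserves (D : AffineConnection E M) (b : FormField E M) : Prop :=
  ∀ (x : M) (Y Z : VecField E M), MDiffAt (T% Y) x → MDiffAt (T% Z) x →
    ∀ v : TangentSpace 𝓘(ℝ, E) x,
      d% (b.app Y Z) x v = b x (D Y x v) (Z x) + b x (Y x) (D Z x v)

/-- `D` preserves the distribution `F`: derivatives of sections of `F` lie in `F`. -/
def PreservesDistribution (D : AffineConnection E M) (F : Distribution E M) : Prop :=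
  ∀ (x : M) (Y : VecField E M), MDiffAt (T% Y) x → (∀ y, Y y ∈ F y) →
    ∀ v : TangentSpace 𝓘(ℝ, E) x, D Y x v ∈ F x

/-- `D` commutes with the field of endomorphisms `T`: `D_v (T Y) = T (D_v Y)`. -/
def CommutesWith (D : AffineConnection E M) (T : EndField E M) : Prop :=
  ∀ (x : M) (Y : VecField E M), MDiffAt (T% Y) x →
    ∀ v : TangentSpace 𝓘(ℝ, E) x, D (T.app Y) x v = T x (D Y x v)

variable [FiniteDimensional ℝ E]

/-- `D` is a Levi-Civita connection of `g`: torsion-free and compatible with `g`. -/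
structure IsLeviCivita (g : FormField E M) (D : AffineConnection E M) : Prop where
  torsion_eq_zero : ∀ x u v, D.torsion x u v = 0
  preserves : Preserves D g

/-- `D` is the Künneth connection of an almost Künneth structure `(Ω, F, G)`: it preserves `F`
and `G`, is compatible with `Ω`, and its mixed torsion vanishes. -/
structure IsKunnethConnection (Ω : FormField E M) (F G : Distribution E M)
    (D : AffineConnection E M) : Prop where
  preserves_F : PreservesDistribution D F
  preserves_G : PreservesDistribution D G
  preserves_Ω : Preserves D Ω
  mixed_torsion : ∀ x, ∀ u ∈ F x, ∀ v ∈ G x, D.torsion x u v = 0 ∧ D.torsion x v u = 0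

end Connections

/-- Averaging of a connection under conjugation with `A`: the operator
`(v, Y) ↦ (1/2) (D_v Y + A D_v (A Y))`. -/
def average (A : EndField E M) (D : AffineConnection E M) (Y : VecField E M) (x : M)
    (v : TangentSpace 𝓘(ℝ, E) x) : TangentSpace 𝓘(ℝ, E) x :=
  (1 / 2 : ℝ) • (D Y x v + A x (D (A.app Y) x v))

/-- The generalized torsion of `D` with respect to `g` vanishes, where `Dg` is the Levi-Civita
connection of `g` and `average A Dg` is the canonical connection `∇ᶜ`:
`g(D_X Y - D_Y X, Z) + g(D_Z X, Y) = g(∇ᶜ_X Y - ∇ᶜ_Y X, Z) + g(∇ᶜ_Z X, Y)`. -/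
def HasVanishingGeneralizedTorsion (g : FormField E M) (A : EndField E M)
    (Dg D : AffineConnection E M) : Prop :=
  ∀ (x : M) (X Y Z : VecField E M), MDiffAt (T% X) x → MDiffAt (T% Y) x → MDiffAt (T% Z) x →
    g x (D Y x (X x) - D X x (Y x)) (Z x) + g x (D X x (Z x)) (Y x) =
      g x (average A Dg Y x (X x) - average A Dg X x (Y x)) (Z x)
        + g x (average A Dg X x (Z x)) (Y x)

namespace BornStructure

variable [FiniteDimensional ℝ E] (S : BornStructure E M)

/-- `D` is the Künneth connection `∇ᴷ` of the almost Künneth structure `(Ω, L₊, L₋)`. -/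
def IsKunneth (D : AffineConnection E M) : Prop :=
  IsKunnethConnection S.Ω (S.L 1) (S.L (-1)) D

/-- `D` is the Born connection `∇ᴮ`: it is compatible with `g`, `h` and `Ω` and has vanishing
generalized torsion. -/
structure IsBorn (D : AffineConnection E M) : Prop where
  preserves_g : Preserves D S.g
  preserves_h : Preserves D S.h
  preserves_Ω : Preserves D S.Ω
  generalized_torsion : ∃ Dg : AffineConnection E M, IsLeviCivita S.g Dg ∧
    HasVanishingGeneralizedTorsion S.g S.A Dg D

end BornStructure

end BornGeometry

end

open scoped Manifold ContDiff
open Bundle VectorField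

noncomputable section

namespace BornGeometry

set_option linter.unusedSectionVars false

/-! ## Differentiability of forms and recursion operators -/

section

variable {E : Type*} [NormedAddCommGroup E] [NormedSpace ℝ E]
  {M : Type*} [TopologicalSpace M] [ChartedSpace E M] [IsManifold 𝓘(ℝ, E) ∞ M]

/-! Everything is expressed through the Levi-Civita connection `∇` of `g`, built from the Koszul
formula (`leviCivita`). The relation `J² = -Id` makes `A` and `B` anticommute, and for anticommuting
operators two vanishing Nijenhuis tensors force that of the product to vanish (`isIntegrable_comp`);
so `A` and `B` are always both integrable.

Closedness of `Ω` and `N_A = 0` give `∇A = 0` (`IsIntegrable.commutesWith_A`). Hence `∇` is itself a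
Künneth connection, and `∇ᶜ = ∇`. The Künneth conditions determine a connection on differentiable
fields (`IsKunneth.unique`), so `∇ᴷ` may be replaced by `∇`.

The average `½(∇ + B∇B) = ∇ + ½B(∇B)` is compatible with `g`, `h` and `Ω`. Its generalized torsion
differs from that of `∇` by half the cyclic sum of `g(B(∇_v B)u, w)`, which vanishes because `N_B =
0`. Uniqueness (`IsIntegrable.eq_averageB`) identifies it with `∇ᴮ`.

Therefore `T^B(u,v) = ½(B(∇_u B)v - B(∇_v B)u)`. On one eigenbundle of `B` this is `-¼ N_B(u,v)`; on
mixed pairs it unfolds to the stated formula. If it vanishes, `g(B(∇_v B)u, w)` is symmetric in `u,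
v` and skew in `u, w`, hence zero. -/

theorem FormField.IsSmooth.mdifferentiableAt {b : FormField E M} (hb : b.IsSmooth) (x : M) :
    MDifferentiableAt 𝓘(ℝ, E) (𝓘(ℝ, E).prod 𝓘(ℝ, E →L[ℝ] E →L[ℝ] ℝ))
    (fun x ↦ TotalSpace.mk' (E →L[ℝ] E →L[ℝ] ℝ) (E := fun x : M ↦
      TangentSpace 𝓘(ℝ, E) x →L[ℝ] TangentSpace 𝓘(ℝ, E) x →L[ℝ] ℝ) x (b x)) x :=
  ContMDiffAt.mdifferentiableAt (n := ∞) (hb x) (by simp)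

theorem FormField.IsSmooth.mdifferentiableAt_app {b : FormField E M} (hb : b.IsSmooth) {x : M}
    {X Y : VecField E M} (hX : MDiffAt (T% X) x) (hY : MDiffAt (T% Y) x) :
    MDiffAt (b.app X Y) x := by
  have h := MDifferentiableAt.clm_bundle_apply₂ (F₁ := E) (F₂ := E) (F₃ := ℝ)
    (E₃ := Bundle.Trivial M ℝ) (hb.mdifferentiableAt x) hX hY
  simp only [mdifferentiableAt_totalSpace] at h
  exact h.2

theorem isInvertible_of_nondegenerate [FiniteDimensional ℝ E] (a : E →L[ℝ] E →L[ℝ] ℝ)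
    (ha : ∀ u, (∀ v, a u v = 0) → u = 0) : a.IsInvertible := by
  have inj : Function.Injective a :=
    (injective_iff_map_eq_zero a).2 fun w hw ↦ ha w fun v ↦ by simp [hw]
  have dim : Module.finrank ℝ E = Module.finrank ℝ (E →L[ℝ] ℝ) := by
    rw [← (LinearMap.toContinuousLinearMap (𝕜 := ℝ) (E := E) (F' := ℝ)).finrank_eq]
    exact (Subspace.dual_finrank_eq (K := ℝ) (V := E)).symm
  exact ⟨(LinearEquiv.ofInjectiveOfFinrankEq a.toLinearMap inj dim).toContinuousLinearEquiv, rfl⟩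

theorem mdifferentiableAt_recursionOperator_app [FiniteDimensional ℝ E] {a b : FormField E M}
    (ha : a.IsNondegenerate) (hsa : a.IsSmooth) (hsb : b.IsSmooth) {x : M} {X : VecField E M}
    (hX : MDiffAt (T% X) x) : MDiffAt (T% ((recursionOperator a b).app X)) x := by
  have h1 := MDifferentiableAt.clm_bundle_apply (F₁ := E) (F₂ := E →L[ℝ] ℝ)
    (E₂ := fun x : M ↦ TangentSpace 𝓘(ℝ, E) x →L[ℝ] ℝ) (hsb.mdifferentiableAt x) hX
  have h2 := hsa.mdifferentiableAt x
  rw [mdifferentiableAt_hom_bundle] at h2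
  replace h2 := h2.2
  rw [mdifferentiableAt_totalSpace] at h1
  replace h1 := h1.2
  rw [mdifferentiableAt_totalSpace]
  refine ⟨mdifferentiableAt_id, ?_⟩
  -- Near `x` the field `a⁻¹ b X` reads in trivializations as the inverse of an operator-valued map
  -- applied to a vector-valued map; inversion is smooth at invertible operators.
  have key : ∀ᶠ y in nhds x,
      (ContinuousLinearMap.inCoordinates E (TangentSpace 𝓘(ℝ, E)) (E →L[ℝ] ℝ)
        (fun x : M ↦ TangentSpace 𝓘(ℝ, E) x →L[ℝ] ℝ) x y x y (a y)).IsInvertible ∧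
      (trivializationAt E (TangentSpace 𝓘(ℝ, E)) x ⟨y, (recursionOperator a b).app X y⟩).2 =
        (ContinuousLinearMap.inCoordinates E (TangentSpace 𝓘(ℝ, E)) (E →L[ℝ] ℝ)
        (fun x : M ↦ TangentSpace 𝓘(ℝ, E) x →L[ℝ] ℝ) x y x y (a y)).inverse
        (trivializationAt (E →L[ℝ] ℝ) (fun x : M ↦ TangentSpace 𝓘(ℝ, E) x →L[ℝ] ℝ) x
          ⟨y, b y (X y)⟩).2 := by
    filter_upwards [(trivializationAt E (TangentSpace 𝓘(ℝ, E)) x).open_baseSet.mem_nhds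
        (FiberBundle.mem_baseSet_trivializationAt' x),
      (trivializationAt (E →L[ℝ] ℝ) (fun x : M ↦ TangentSpace 𝓘(ℝ, E) x →L[ℝ] ℝ) x
        ).open_baseSet.mem_nhds (FiberBundle.mem_baseSet_trivializationAt' x)] with y hy hy'
    have inv := isInvertible_of_nondegenerate (E := E) (a y) (ha y)
    have inv' : (ContinuousLinearMap.inCoordinates E (TangentSpace 𝓘(ℝ, E)) (E →L[ℝ] ℝ)
        (fun x : M ↦ TangentSpace 𝓘(ℝ, E) x →L[ℝ] ℝ) x y x y (a y)).IsInvertible := by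
      rw [ContinuousLinearMap.inCoordinates_eq hy hy']
      rw [ContinuousLinearMap.isInvertible_equiv_comp, ContinuousLinearMap.isInvertible_comp_equiv]
      exact inv
    refine ⟨inv', ?_⟩
    obtain ⟨f, hf⟩ := inv'
    rw [← hf, ContinuousLinearMap.inverse_equiv]
    rw [ContinuousLinearEquiv.coe_coe, ContinuousLinearEquiv.eq_symm_apply,
      ← ContinuousLinearEquiv.coe_coe f, hf,
      ContinuousLinearMap.inCoordinates_eq hy hy']
    have h : a y ((recursionOperator a b).app X y) = b y (X y) :=
      apply_inverse_of_nondegenerate (E := E) (a y) (ha y) (b y (X y))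
    have h' : ((trivializationAt E (TangentSpace 𝓘(ℝ, E)) x).continuousLinearEquivAt ℝ y hy).symm
        (trivializationAt E (TangentSpace 𝓘(ℝ, E)) x ⟨y, (recursionOperator a b).app X y⟩).2 =
          (recursionOperator a b).app X y :=
      ((trivializationAt E (TangentSpace 𝓘(ℝ, E)) x).continuousLinearEquivAt ℝ y
        hy).symm_apply_apply _
    rw [ContinuousLinearMap.comp_apply, ContinuousLinearMap.comp_apply,
      ContinuousLinearEquiv.coe_coe, ContinuousLinearEquiv.coe_coe, h', h]
    rfl
  have hinv := ContinuousLinearMap.IsInvertible.contDiffAt_map_inverse (n := 1)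
    key.self_of_nhds.1
  have hc := (hinv.differentiableAt (by simp)).mdifferentiableAt.comp x h2
  exact (hc.clm_apply h1).congr_of_eventuallyEq (key.mono fun y hy ↦ hy.2)

end

section

variable {E : Type*} [NormedAddCommGroup E] [NormedSpace ℝ E]
  {M : Type*} [TopologicalSpace M] [ChartedSpace E M] [IsManifold 𝓘(ℝ, E) ∞ M]

/-! ## The Levi-Civita connection -/

theorem FormField.app_add_left (b : FormField E M) (X X' Y : VecField E M) :
    b.app (X + X') Y = fun x ↦ b.app X Y x + b.app X' Y x := by
  ext x; simp [FormField.app]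

theorem FormField.app_add_right (b : FormField E M) (X Y Y' : VecField E M) :
    b.app X (Y + Y') = fun x ↦ b.app X Y x + b.app X Y' x := by
  ext x; simp [FormField.app]

theorem FormField.app_smul_left (b : FormField E M) (f : M → ℝ) (X Y : VecField E M) :
    b.app (f • X) Y = fun x ↦ f x * b.app X Y x := by
  ext x; simp [FormField.app]

theorem FormField.app_smul_right (b : FormField E M) (f : M → ℝ) (X Y : VecField E M) :
    b.app X (f • Y) = fun x ↦ f x * b.app X Y x := by
  ext x; simp [FormField.app]

/-- The right hand side of the Koszul formula for `2 g(∇_X Y, Z)`. -/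
def koszul (g : FormField E M) (Y X Z : VecField E M) (x : M) : ℝ :=
  d% (g.app Y Z) x (X x) + d% (g.app X Z) x (Y x) - d% (g.app X Y) x (Z x)
    + g x (mlieBracket 𝓘(ℝ, E) X Y x) (Z x) - g x (mlieBracket 𝓘(ℝ, E) X Z x) (Y x)
    - g x (mlieBracket 𝓘(ℝ, E) Y Z x) (X x)

variable [FiniteDimensional ℝ E]

/-- The derivatives of `f` coming from the differentiated metric terms cancel those coming from the
brackets. -/
theorem koszul_tensorial_direction {g : FormField E M} (hg : g.IsPseudoRiemannian) {x : M}
    {Y Z : VecField E M} (hY : MDiffAt (T% Y) x) (hZ : MDiffAt (T% Z) x) :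
    TensorialAt 𝓘(ℝ, E) E (fun X ↦ koszul g Y X Z x) x where
  smul {f X} hf hX := by
    simp only [koszul, FormField.app_smul_left,
      mvfderiv_fun_mul hf (hg.smooth.mdifferentiableAt_app hX hY),
      mvfderiv_fun_mul hf (hg.smooth.mdifferentiableAt_app hX hZ),
      mlieBracket_smul_left hf hX]
    simp [FormField.app]
    ring
  add {X X'} hX hX' := by
    simp only [koszul, FormField.app_add_left, mlieBracket_add_left hX hX',
      mvfderiv_fun_add (hg.smooth.mdifferentiableAt_app hX hY)
        (hg.smooth.mdifferentiableAt_app hX' hY),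
      mvfderiv_fun_add (hg.smooth.mdifferentiableAt_app hX hZ)
        (hg.smooth.mdifferentiableAt_app hX' hZ)]
    simp
    ring

theorem koszul_tensorial_test {g : FormField E M} (hg : g.IsPseudoRiemannian) {x : M}
    {Y X : VecField E M} (hY : MDiffAt (T% Y) x) (hX : MDiffAt (T% X) x) :
    TensorialAt 𝓘(ℝ, E) E (fun Z ↦ koszul g Y X Z x) x where
  smul {f Z} hf hZ := by
    simp only [koszul, FormField.app_smul_right,
      mvfderiv_fun_mul hf (hg.smooth.mdifferentiableAt_app hX hZ),
      mvfderiv_fun_mul hf (hg.smooth.mdifferentiableAt_app hY hZ),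
      mlieBracket_smul_right hf hZ]
    simp [FormField.app]
    rw [hg.symm x (Z x) (X x), hg.symm x (Z x) (Y x)]
    ring
  add {Z Z'} hZ hZ' := by
    simp only [koszul, FormField.app_add_right, mlieBracket_add_right hZ hZ',
      mvfderiv_fun_add (hg.smooth.mdifferentiableAt_app hX hZ)
        (hg.smooth.mdifferentiableAt_app hX hZ'),
      mvfderiv_fun_add (hg.smooth.mdifferentiableAt_app hY hZ)
        (hg.smooth.mdifferentiableAt_app hY hZ')]
    simp
    ring

theorem koszul_add {g : FormField E M} (hg : g.IsPseudoRiemannian) {x : M}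
    {Y Y' X Z : VecField E M} (hY : MDiffAt (T% Y) x) (hY' : MDiffAt (T% Y') x)
    (hX : MDiffAt (T% X) x) (hZ : MDiffAt (T% Z) x) :
    koszul g (Y + Y') X Z x = koszul g Y X Z x + koszul g Y' X Z x := by
  simp only [koszul, FormField.app_add_right, FormField.app_add_left,
    mlieBracket_add_right hY hY', mlieBracket_add_left hY hY',
    mvfderiv_fun_add (hg.smooth.mdifferentiableAt_app hY hZ)
        (hg.smooth.mdifferentiableAt_app hY' hZ),
    mvfderiv_fun_add (hg.smooth.mdifferentiableAt_app hX hY)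
        (hg.smooth.mdifferentiableAt_app hX hY')]
  simp
  ring

/-- In the differentiated slot the terms in `df` do not all cancel: the surplus is, after halving,
the Leibniz term. -/
theorem koszul_smul {g : FormField E M} (hg : g.IsPseudoRiemannian) {x : M} {f : M → ℝ}
    {Y X Z : VecField E M} (hf : MDiffAt f x) (hY : MDiffAt (T% Y) x)
    (hX : MDiffAt (T% X) x) (hZ : MDiffAt (T% Z) x) :
    koszul g (f • Y) X Z x =
      f x * koszul g Y X Z x + 2 * (d% f x (X x) * g x (Y x) (Z x)) := by
  simp only [koszul, FormField.app_smul_right, FormField.app_smul_left,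
    mlieBracket_smul_right hf hY, mlieBracket_smul_left hf hY,
    mvfderiv_fun_mul hf (hg.smooth.mdifferentiableAt_app hY hZ),
    mvfderiv_fun_mul hf (hg.smooth.mdifferentiableAt_app hX hY)]
  simp [FormField.app, hg.symm x (Y x) (X x)]
  ring

open Classical in
/-- The Levi-Civita connection at a point, as a function of the vector field. -/
def leviCivitaFun {g : FormField E M} (hg : g.IsPseudoRiemannian) (Y : VecField E M) (x : M) :
    TangentSpace 𝓘(ℝ, E) x →L[ℝ] TangentSpace 𝓘(ℝ, E) x :=
  if hY : MDiffAt (T% Y) x then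
    (1 / 2 : ℝ) • ((g x).inverse ∘L
      TensorialAt.mkHom₂ (I := 𝓘(ℝ, E)) (F := E) (F' := E) (fun X Z ↦ koszul g Y X Z x) x
        (fun _ hZ ↦ koszul_tensorial_direction hg hY hZ)
        (fun _ hX ↦ koszul_tensorial_test hg hY hX))
  -- The value off differentiable fields is arbitrary, as the axioms of a covariant derivative only
  -- test differentiable ones.
  else 0

theorem leviCivitaFun_spec {g : FormField E M} (hg : g.IsPseudoRiemannian) {x : M}
    {Y X Z : VecField E M} (hY : MDiffAt (T% Y) x) (hX : MDiffAt (T% X) x)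
    (hZ : MDiffAt (T% Z) x) :
    2 * g x (leviCivitaFun hg Y x (X x)) (Z x) = koszul g Y X Z x := by
  rw [leviCivitaFun, dif_pos hY]
  have h := TensorialAt.mkHom₂_apply (I := 𝓘(ℝ, E)) (F := E) (F' := E)
    (Φ := fun X Z ↦ koszul g Y X Z x)
        (fun _ hZ ↦ koszul_tensorial_direction hg hY hZ)
        (fun _ hX ↦ koszul_tensorial_test hg hY hX) hX hZ
  rw [← h]
  have h' := apply_inverse_of_nondegenerate (E := E) (g x) (hg.nondegenerate x)
    (TensorialAt.mkHom₂ (I := 𝓘(ℝ, E)) (F := E) (F' := E) (fun X Z ↦ koszul g Y X Z x) x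
        (fun _ hZ ↦ koszul_tensorial_direction hg hY hZ)
        (fun _ hX ↦ koszul_tensorial_test hg hY hX) (X x))
  have h'' := congrArg (fun l : E →L[ℝ] ℝ ↦ l (Z x)) h'
  refine Eq.trans ?_ h''
  simp
  rfl

theorem FormField.IsPseudoRiemannian.app_comm {g : FormField E M} (hg : g.IsPseudoRiemannian)
    (X Y : VecField E M) : g.app X Y = g.app Y X :=
  funext fun x ↦ hg.symm x (X x) (Y x)

theorem FormField.IsNondegenerate.ext {b : FormField E M} (hb : b.IsNondegenerate) {x : M}
    {u v : TangentSpace 𝓘(ℝ, E) x} (h : ∀ w, b x u w = b x v w) : u = v :=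
  sub_eq_zero.1 (hb x _ fun w ↦ by simp [h])

/-- Reduces pointwise identities between tensors to identities for vector fields differentiable at
the point. -/
theorem exists_vecField {x : M} (u : TangentSpace 𝓘(ℝ, E) x) :
    ∃ X : VecField E M, MDiffAt (T% X) x ∧ X x = u :=
  ⟨FiberBundle.extend E u, FiberBundle.mdifferentiableAt_extend .., FiberBundle.extend_apply_self E u⟩

/-- The Levi-Civita connection of a pseudo-Riemannian metric. -/
def leviCivita {g : FormField E M} (hg : g.IsPseudoRiemannian) : AffineConnection E M where
  toFun := leviCivitaFun hg
  isCovariantDerivativeOnUniv :=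
  { add := by
      intro Y Y' x hY hY' _
      ext v
      refine hg.nondegenerate.ext fun w ↦ mul_left_cancel₀ (two_ne_zero (α := ℝ)) ?_
      obtain ⟨V, hV, rfl⟩ := exists_vecField v
      obtain ⟨W, hW, rfl⟩ := exists_vecField w
      rw [leviCivitaFun_spec hg (mdifferentiableAt_add_section hY hY') hV hW,
        koszul_add hg hY hY' hV hW, ← leviCivitaFun_spec hg hY hV hW,
        ← leviCivitaFun_spec hg hY' hV hW]
      simp
      ring
    leibniz := by
      intro Y f x hY hf _
      ext v
      refine hg.nondegenerate.ext fun w ↦ mul_left_cancel₀ (two_ne_zero (α := ℝ)) ?_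
      obtain ⟨V, hV, rfl⟩ := exists_vecField v
      obtain ⟨W, hW, rfl⟩ := exists_vecField w
      rw [leviCivitaFun_spec hg (hf.smul_section hY) hV hW, koszul_smul hg hf hY hV hW,
        ← leviCivitaFun_spec hg hY hV hW]
      simp
      ring }

theorem leviCivita_spec {g : FormField E M} (hg : g.IsPseudoRiemannian) {x : M}
    {Y X Z : VecField E M} (hY : MDiffAt (T% Y) x) (hX : MDiffAt (T% X) x)
    (hZ : MDiffAt (T% Z) x) :
    2 * g x (leviCivita hg Y x (X x)) (Z x) = koszul g Y X Z x :=
  leviCivitaFun_spec hg hY hX hZ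

theorem isLeviCivita_leviCivita {g : FormField E M} (hg : g.IsPseudoRiemannian) :
    IsLeviCivita g (leviCivita hg) where
  torsion_eq_zero x u v := by
    refine hg.nondegenerate.ext fun w ↦ mul_left_cancel₀ (two_ne_zero (α := ℝ)) ?_
    obtain ⟨U, hU, rfl⟩ := exists_vecField u
    obtain ⟨V, hV, rfl⟩ := exists_vecField v
    obtain ⟨W, hW, rfl⟩ := exists_vecField w
    have h := (leviCivita hg).torsion_apply hU hV
    rw [h]
    simp only [map_sub, sub_apply, mul_sub, leviCivita_spec hg hU hV hW,
      leviCivita_spec hg hV hU hW]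
    simp only [koszul, hg.app_comm V U, mlieBracket_swap_apply (V := V) (W := U)]
    simp
    ring
  preserves x Y Z hY hZ v := by
    refine mul_left_cancel₀ (two_ne_zero (α := ℝ)) ?_
    obtain ⟨V, hV, rfl⟩ := exists_vecField v
    rw [mul_add, leviCivita_spec hg hY hV hZ, hg.symm x (Y x), leviCivita_spec hg hZ hV hY]
    simp only [koszul, hg.app_comm Z Y, mlieBracket_swap_apply (V := Z) (W := Y)]
    simp
    ring

end

/-! ## Nijenhuis tensors of anticommuting fields of endomorphisms -/

section

variable {E : Type*} [NormedAddCommGroup E] [NormedSpace ℝ E]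
  {M : Type*} [TopologicalSpace M] [ChartedSpace E M] [IsManifold 𝓘(ℝ, E) ∞ M]

namespace EndField

/-- A field of endomorphisms is differentiable if it maps differentiable vector fields to
differentiable vector fields. -/
def IsDifferentiable (T : EndField E M) : Prop :=
  ∀ ⦃x : M⦄ ⦃X : VecField E M⦄, MDiffAt (T% X) x → MDiffAt (T% (T.app X)) x

theorem app_add (T : EndField E M) (X Y : VecField E M) : T.app (X + Y) = T.app X + T.app Y := by
  ext x; simp [app]

theorem app_smul (T : EndField E M) (f : M → ℝ) (X : VecField E M) :
    T.app (f • X) = f • T.app X := by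
  ext x; simp [app]

theorem app_app_of_sq {T : EndField E M} {c : ℝ} (hT : ∀ x u, T x (T x u) = c • u)
    (X : VecField E M) : T.app (T.app X) = c • X := by
  ext x; simp [app, hT]

/-- The Nijenhuis concomitant of two anticommuting fields of endomorphisms. -/
def concomitant (P Q : EndField E M) (X Y : VecField E M) (x : M) : TangentSpace 𝓘(ℝ, E) x :=
  mlieBracket 𝓘(ℝ, E) (P.app X) (Q.app Y) x + mlieBracket 𝓘(ℝ, E) (Q.app X) (P.app Y) x
    - P x (mlieBracket 𝓘(ℝ, E) (Q.app X) Y x) - P x (mlieBracket 𝓘(ℝ, E) X (Q.app Y) x)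
    - Q x (mlieBracket 𝓘(ℝ, E) (P.app X) Y x) - Q x (mlieBracket 𝓘(ℝ, E) X (P.app Y) x)

theorem concomitant_comm (P Q : EndField E M) (X Y : VecField E M) (x : M) :
    concomitant P Q X Y x = concomitant Q P X Y x := by
  unfold concomitant; abel

variable [FiniteDimensional ℝ E]

theorem IsIntegrable.mlieBracket_app_app {T : EndField E M} (hT : T.IsIntegrable) {c : ℝ}
    (hc : ∀ x u, T x (T x u) = c • u) {x : M} {X Y : VecField E M}
    (hX : MDiffAt (T% X) x) (hY : MDiffAt (T% Y) x) :
    mlieBracket 𝓘(ℝ, E) (T.app X) (T.app Y) x =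
      T x (mlieBracket 𝓘(ℝ, E) (T.app X) Y x) + T x (mlieBracket 𝓘(ℝ, E) X (T.app Y) x)
        - c • mlieBracket 𝓘(ℝ, E) X Y x := by
  have h := hT x X Y hX hY
  rw [nijenhuis, hc] at h
  rw [← sub_eq_zero, ← h]
  abel

theorem nijenhuis_app_left {T : EndField E M} {c : ℝ} (hc : ∀ x u, T x (T x u) = c • u) {x : M}
    {X : VecField E M} (Y : VecField E M) (hX : MDiffAt (T% X) x) :
    T.nijenhuis (T.app X) Y x = -T x (T.nijenhuis X Y x) := by
  simp only [nijenhuis, app_app_of_sq hc, mlieBracket_const_smul_left hX, map_sub, map_add, hc,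
    map_smul]
  abel

section Anticommuting

variable {P Q : EndField E M} {p q : ℝ} (hp : ∀ x u, P x (P x u) = p • u)
  (hq : ∀ x u, Q x (Q x u) = q • u) (hPQ : ∀ x u, Q x (P x u) = -P x (Q x u))
  (dP : P.IsDifferentiable) (dQ : Q.IsDifferentiable) (iP : P.IsIntegrable) (iQ : Q.IsIntegrable)

theorem app_app_of_anticommute (hPQ : ∀ x u, Q x (P x u) = -P x (Q x u)) (X : VecField E M) :
    Q.app (P.app X) = (-1 : ℝ) • P.app (Q.app X) := by
  ext x; simp [app, hPQ]

include hp hPQ dP dQ iP in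
theorem concomitant_app_left {x : M} {X Y : VecField E M} (hX : MDiffAt (T% X) x)
    (hY : MDiffAt (T% Y) x) :
    concomitant P Q (P.app X) Y x = -P x (concomitant P Q X Y x) := by
  simp only [concomitant, app_app_of_sq hp, app_app_of_anticommute hPQ,
    mlieBracket_const_smul_left hX, mlieBracket_const_smul_left (dP (dQ hX)),
    iP.mlieBracket_app_app hp hX hY, iP.mlieBracket_app_app hp (dQ hX) hY,
    map_sub, map_add, map_smul, hp, hPQ]
  module

include hp hq hPQ dP dQ iP iQ in
-- `N_P = 0` at `(QX, QY)` expands `[PQX, PQY]`; `N_Q = 0` at `(X, Y)`, `(PX, Y)` and `(X, PY)`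
-- removes the remaining brackets that are quadratic in `Q`.
theorem nijenhuis_comp {R : EndField E M} (hR : ∀ x u, R x u = P x (Q x u)) {x : M}
    {X Y : VecField E M} (hX : MDiffAt (T% X) x) (hY : MDiffAt (T% Y) x) :
    R.nijenhuis X Y x = -R x (concomitant P Q X Y x) := by
  have hRa (Z : VecField E M) : R.app Z = P.app (Q.app Z) := by ext y; simp [app, hR]
  have h1 := iQ.mlieBracket_app_app hq (dP hX) hY
  have h2 := iQ.mlieBracket_app_app hq hX (dP hY)
  simp only [app_app_of_anticommute hPQ, mlieBracket_const_smul_left (dP (dQ hX)),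
    mlieBracket_const_smul_right (dP (dQ hY))] at h1 h2
  replace h1 := congrArg (fun u ↦ P x u) h1
  replace h2 := congrArg (fun u ↦ P x u) h2
  simp only [map_sub, map_add, map_smul] at h1 h2
  simp only [nijenhuis, hR, hRa, concomitant, iP.mlieBracket_app_app hp (dQ hX) (dQ hY),
    iQ.mlieBracket_app_app hq hX hY, map_sub, map_add, map_smul, hp, hq, hPQ, map_neg]
  linear_combination (norm := module) -h1 - h2

include hp hq hPQ dP dQ iP iQ in
-- Let `C` be the concomitant of `P` and `Q` at `(X, Y)`, so `N_R(X,Y) = -R C`, and `R² = -pq`.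
-- Computed from `N_R(RX,Y) = -R N_R(X,Y)`, the value `N_R(RX,Y)` is `-pq C`; computed by moving `P`
-- and `Q` out of the concomitant, it is `pq C`. Thus `2pq C = 0`.
theorem isIntegrable_comp (hpq : p * q ≠ 0) {R : EndField E M}
    (hR : ∀ x u, R x u = P x (Q x u)) : R.IsIntegrable := by
  have hQP (x u) : P x (Q x u) = -Q x (P x u) := by rw [hPQ, neg_neg]
  have hRa (Z : VecField E M) : R.app Z = P.app (Q.app Z) := by ext y; simp [app, hR]
  have hRR (x u) : R x (R x u) = (-(p * q)) • u := by
    simp only [hR, hPQ, map_neg, hp, hq, map_smul]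
    module
  intro x X Y hX hY
  have h1 := nijenhuis_comp hp hq hPQ dP dQ iP iQ hR hX hY
  have h2 := nijenhuis_comp hp hq hPQ dP dQ iP iQ hR (hRa X ▸ dP (dQ hX)) hY
  rw [nijenhuis_app_left hRR Y hX, hRa, concomitant_app_left hp hPQ dP dQ iP (dQ hX) hY,
    concomitant_comm, concomitant_app_left hq hQP dQ dP iQ hX hY, h1] at h2
  rw [concomitant_comm Q P] at h2
  simp only [map_neg, neg_neg, ← hR, hRR] at h2
  have h3 : concomitant P Q X Y x = 0 := by
    have : (2 * (p * q)) • concomitant P Q X Y x = 0 := by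
      linear_combination (norm := module) - h2
    exact (smul_eq_zero.1 this).resolve_left (by simpa using hpq)
  rw [h1, h3]
  simp

end Anticommuting

end EndField

end

/-! ## Trilinear identities -/

section

section TrilinearIdentities

variable {V : Type*} {A B : V → V}

/-- The algebra showing that a closed 2-form with integrable recursion operator is parallel. -/
theorem trilinear_eq_zero_of_closed {α : V → V → V → ℝ} (hA : ∀ u, A (A u) = u)
    (skew : ∀ v u w, α v u w = -α v w u) (comm : ∀ v u w, α v (A u) w = α v u (A w))
    (closed : ∀ u v w, α u v w + α v w u + α w u v = 0)
    (nij : ∀ u v w, α (A u) v w - α (A v) u w + α u v (A w) - α v u (A w) = 0) (u v w : V) :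
    α u v w = 0 := by
  -- The left side is symmetric in `x, y` by `nij` and skew in `y, z` by `skew` and `comm`, hence
  -- zero.
  have hFG (x y z : V) : α (A x) y z + α x y (A z) = 0 := by
    have e1 := nij x y z
    have e2 := nij y z x
    have e3 := nij z x y
    linarith [skew (A x) y z, skew x y (A z), skew (A y) z x, skew y z (A x), skew (A z) x y,
      skew z x (A y), comm x y z, comm y z x, comm z x y, comm x z y, comm y x z, comm z y x]
  have hG (x y z : V) : -α x y (A z) + α y z (A x) + α z x (A y) = 0 := by
    linarith [closed (A x) y z, hFG x y z, comm z x y]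
  -- Adding two cyclic permutations of `hG` leaves twice a single term.
  have key (x y z : V) : α x y (A z) = 0 := by linarith [hG x y z, hG y z x, hG z x y]
  simpa [hA] using key u v (A w)

/-- The algebra behind the vanishing of the generalized torsion. -/
theorem trilinear_cyclic_eq_zero {c : V → V → V → ℝ}
    (skew : ∀ v u w, c v u w = -c v w u) (anti : ∀ v u w, c v (B u) w = -c v u (B w))
    (nij : ∀ u v w, c (B u) v (B w) - c (B v) u (B w) - c u v w + c v u w = 0) (u v w : V) :
    c u v w + c v w u + c w u v = 0 := by
  have h (x y z : V) : c (B x) (B y) z - c (B y) (B x) z + c x y z - c y x z = 0 := by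
    linarith [nij x y z, anti (B x) y z, anti (B y) x z]
  -- By this symmetry the terms with two `B`s cancel in the cyclic sum of `h`, leaving twice the
  -- cyclic sum of `c`.
  have h' (x y z : V) : c (B x) (B y) z = c (B x) (B z) y := by
    linarith [skew (B x) (B y) z, anti (B x) z y]
  linarith [h u v w, h v w u, h w u v, h' u v w, h' v w u, h' w u v, skew u v w, skew v w u,
    skew w u v]

/-- The algebra behind the uniqueness of the Born connection. -/
theorem trilinear_eq_zero_of_cyclic {s : V → V → V → ℝ} (hA : ∀ u, A (A u) = u)
    (hB : ∀ u, B (B u) = u) (hAB : ∀ v u w, s v (A (B u)) w = -s v (B (A u)) w)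
    (commA : ∀ v u w, s v (A u) w = -s v u (A w)) (commB : ∀ v u w, s v (B u) w = s v u (B w))
    (cyclic : ∀ u v w, s u v w + s v w u + s w u v = 0) (u v w : V) : s u v w = 0 := by
  have h (x y z : V) : s x y z = s (B x) (B y) z := by
    have h1 := cyclic (B x) (B y) z
    have h2 := cyclic (B x) y (B z)
    have h3 := cyclic x (B y) (B z)
    have e (x y z : V) : s x (B y) (B z) = s x y z := by rw [commB, hB]
    linarith [e z x y, e y z x, e x y z, commB (B y) z x, commB (B x) y z, commB (B z) x y,
      cyclic x y z]
  -- The chain is `s(u,v,w) = -s(u,Av,Aw) = -s(Bu,BAv,Aw) = s(Bu,ABv,Aw) = -s(Bu,Bv,w) = -s(u,v,w)`.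
  have h1 : s u v w = -s u (A v) (A w) := by rw [commA, hA, neg_neg]
  have h2 := h u (A v) (A w)
  have h3 := hAB (B u) v (A w)
  have h4 := commA (B u) (B v) (A w)
  rw [hA] at h4
  linarith [h u v w]

/-- The algebra behind the uniqueness of the Künneth connection. -/
theorem trilinear_eq_zero_of_mixed {s : V → V → V → ℝ} (hA : ∀ u, A (A u) = u)
    (symm : ∀ v u w, s v u w = s v w u) (anti : ∀ v u w, s v (A u) w = -s v u (A w))
    (mixed : ∀ u v w, s u v w - s u (A v) w + s (A u) v w - s (A u) (A v) w =
      s v u w + s v (A u) w - s (A v) u w - s (A v) (A u) w) (u v w : V) : s u v w = 0 := by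
  have h (x y z : V) : s (A x) y z = s x (A y) z := by
    have e1 := mixed x y z
    have e2 := mixed x y (A z)
    have e3 := mixed y x z
    have e4 := mixed y x (A z)
    have a (x y : V) : s x y (A z) = -s x (A y) z := by rw [anti, neg_neg]
    simp only [a, hA] at e2 e4
    linarith
  -- Moving `A` around gives `s(x,Ay,z) = s(Ax,y,z) = s(Ax,z,y) = s(x,Az,y) = s(x,y,Az) =
  -- -s(x,Ay,z)`.
  have key (x y z : V) : s x (A y) z = 0 := by
    linarith [anti x y z, symm x y (A z), h x (A z) y, h x y z, symm (A x) (A z) y, h x z y,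
      symm (A x) y z, symm x (A y) z, symm x (A z) y, symm (A x) z y]
  simpa [hA] using key u (A v) w

end TrilinearIdentities

end

/-! ## Connections and fields of endomorphisms -/

section

variable {E : Type*} [NormedAddCommGroup E] [NormedSpace ℝ E]
  {M : Type*} [TopologicalSpace M] [ChartedSpace E M] [IsManifold 𝓘(ℝ, E) ∞ M]

namespace AffineConnection

variable (D : AffineConnection E M)

theorem map_add {x : M} {X Y : VecField E M} (hX : MDiffAt (T% X) x) (hY : MDiffAt (T% Y) x) :
    D (X + Y) x = D X x + D Y x :=
  D.isCovariantDerivativeOnUniv.add hX hY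

theorem map_smul {x : M} {X : VecField E M} {f : M → ℝ} (hf : MDiffAt f x)
    (hX : MDiffAt (T% X) x) : D (f • X) x = f x • D X x + (d% f x).smulRight (X x) :=
  D.isCovariantDerivativeOnUniv.leibniz hX hf

theorem map_const_smul {x : M} {X : VecField E M} (c : ℝ) (hX : MDiffAt (T% X) x) :
    D (c • X) x = c • D X x :=
  D.isCovariantDerivativeOnUniv.smul_const c hX

end AffineConnection

open AffineConnection

variable [FiniteDimensional ℝ E]

/-! ### The covariant derivative of a field of endomorphisms -/

theorem tensorial_endDeriv (D : AffineConnection E M) {T : EndField E M}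
    (hT : T.IsDifferentiable) (x : M) :
    TensorialAt 𝓘(ℝ, E) E (fun Y ↦ D (T.app Y) x - T x ∘L D Y x) x where
  smul {f Y} hf hY := by
    ext v
    simp only [T.app_smul, map_smul D hf hY, map_smul D hf (hT hY)]
    simp [EndField.app]
    module
  add {Y Y'} hY hY' := by
    ext v
    simp only [T.app_add, map_add D hY hY', map_add D (hT hY) (hT hY')]
    simp
    abel

/-- The covariant derivative `(D T) Y v = D_v (T Y) - T (D_v Y)` of a field of endomorphisms. -/
def endDeriv (D : AffineConnection E M) {T : EndField E M} (hT : T.IsDifferentiable) (x : M) :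
    TangentSpace 𝓘(ℝ, E) x →L[ℝ] TangentSpace 𝓘(ℝ, E) x →L[ℝ] TangentSpace 𝓘(ℝ, E) x :=
  TensorialAt.mkHom _ x (tensorial_endDeriv D hT x)

theorem apply_app {D : AffineConnection E M} {T : EndField E M} (hT : T.IsDifferentiable) {x : M}
    {Y : VecField E M} (hY : MDiffAt (T% Y) x) (v : TangentSpace 𝓘(ℝ, E) x) :
    D (T.app Y) x v = T x (D Y x v) + endDeriv D hT x (Y x) v := by
  rw [endDeriv, TensorialAt.mkHom_apply _ hY]
  simp

theorem commutesWith_iff {D : AffineConnection E M} {T : EndField E M} (hT : T.IsDifferentiable) :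
    CommutesWith D T ↔ ∀ x u v, endDeriv D hT x u v = 0 := by
  constructor
  · intro h x u v
    obtain ⟨U, hU, rfl⟩ := exists_vecField u
    simpa [apply_app hT hU] using h x U hU v
  · intro h x Y hY v
    rw [apply_app hT hY, h, add_zero]

/-- Differentiating `T² = c` shows that `DT` anticommutes with `T`. -/
theorem endDeriv_app {D : AffineConnection E M} {T : EndField E M} (hT : T.IsDifferentiable)
    {c : ℝ} (hc : ∀ x u, T x (T x u) = c • u) (x : M) (u v : TangentSpace 𝓘(ℝ, E) x) :
    endDeriv D hT x (T x u) v = -T x (endDeriv D hT x u v) := by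
  obtain ⟨U, hU, rfl⟩ := exists_vecField u
  have h := apply_app (D := D) hT (hT hU) v
  rw [EndField.app_app_of_sq hc, map_const_smul D c hU, apply_app hT hU, _root_.map_add, hc] at h
  exact (neg_eq_of_add_eq_zero_right (by simpa [add_assoc, EndField.app] using h)).symm

theorem endDeriv_adjoint {D : AffineConnection E M} {T : EndField E M} (hT : T.IsDifferentiable)
    {a : FormField E M} (hD : Preserves D a) (ha : a.IsSmooth) {δ : ℝ}
    (hδ : ∀ x u v, a x (T x u) v = δ * a x u (T x v)) (x : M) (u v w : TangentSpace 𝓘(ℝ, E) x) :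
    a x (endDeriv D hT x u v) w = δ * a x u (endDeriv D hT x w v) := by
  obtain ⟨U, hU, rfl⟩ := exists_vecField u
  obtain ⟨W, hW, rfl⟩ := exists_vecField w
  have h1 := hD x (T.app U) W (hT hU) hW v
  have h2 := hD x U (T.app W) hU (hT hW) v
  have h3 : a.app (T.app U) W = fun y ↦ δ * a.app U (T.app W) y := by
    ext y; exact hδ y _ _
  rw [h3, mvfderiv_fun_mul mdifferentiableAt_const (ha.mdifferentiableAt_app hU (hT hW)),
    mvfderiv_const] at h1
  simp only [apply_app hT hU, apply_app hT hW, _root_.map_add, add_apply, hδ] at h1 h2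
  simp [h2, EndField.app, hδ] at h1
  linear_combination -h1

theorem nijenhuis_eq {D : AffineConnection E M} (hD : ∀ x u v, D.torsion x u v = 0)
    {T : EndField E M} (hT : T.IsDifferentiable) {x : M} {X Y : VecField E M}
    (hX : MDiffAt (T% X) x) (hY : MDiffAt (T% Y) x) :
    T.nijenhuis X Y x = endDeriv D hT x (Y x) (T x (X x)) - endDeriv D hT x (X x) (T x (Y x))
      - T x (endDeriv D hT x (Y x) (X x)) + T x (endDeriv D hT x (X x) (Y x)) := by
  have br {X Y : VecField E M} (hX : MDiffAt (T% X) x) (hY : MDiffAt (T% Y) x) :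
      mlieBracket 𝓘(ℝ, E) X Y x = D Y x (X x) - D X x (Y x) := by
    have h := D.torsion_apply hX hY
    rw [hD] at h
    exact (sub_eq_zero.1 h.symm).symm
  simp only [EndField.nijenhuis, br hX hY, br (hT hX) hY, br hX (hT hY), br (hT hX) (hT hY),
    apply_app hT hX, apply_app hT hY, map_sub, _root_.map_add]
  simp only [EndField.app]
  abel

theorem endDeriv_of_isIntegrable {D : AffineConnection E M} (hD : ∀ x u v, D.torsion x u v = 0)
    {T : EndField E M} (hT : T.IsDifferentiable) (iT : T.IsIntegrable) (x : M)
    (u v : TangentSpace 𝓘(ℝ, E) x) :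
    endDeriv D hT x v (T x u) - endDeriv D hT x u (T x v) - T x (endDeriv D hT x v u)
      + T x (endDeriv D hT x u v) = 0 := by
  obtain ⟨U, hU, rfl⟩ := exists_vecField u
  obtain ⟨V, hV, rfl⟩ := exists_vecField v
  rw [← nijenhuis_eq hD hT hU hV]
  exact iT x U V hU hV

/-- For torsion-free `D` the exterior derivative is the cyclic sum of `D b`, and `D b = a((D T)·,
·)` since `a` is parallel. -/
theorem extDeriv_eq {D : AffineConnection E M} (hD : ∀ x u v, D.torsion x u v = 0)
    {T : EndField E M} (hT : T.IsDifferentiable) {a b : FormField E M} (ha : Preserves D a)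
    (hab : ∀ x u v, a x (T x u) v = b x u v) (skew : ∀ x u v, b x u v = -b x v u)
    {x : M} {X Y Z : VecField E M}
    (hX : MDiffAt (T% X) x) (hY : MDiffAt (T% Y) x) (hZ : MDiffAt (T% Z) x) :
    b.extDeriv X Y Z x = a x (endDeriv D hT x (Y x) (X x)) (Z x)
      + a x (endDeriv D hT x (Z x) (Y x)) (X x) + a x (endDeriv D hT x (X x) (Z x)) (Y x) := by
  have br {X Y : VecField E M} (hX : MDiffAt (T% X) x) (hY : MDiffAt (T% Y) x) :
      mlieBracket 𝓘(ℝ, E) X Y x = D Y x (X x) - D X x (Y x) := by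
    have h := D.torsion_apply hX hY
    rw [hD] at h
    exact (sub_eq_zero.1 h.symm).symm
  have der {Y Z : VecField E M} (hY : MDiffAt (T% Y) x) (hZ : MDiffAt (T% Z) x)
      (v : TangentSpace 𝓘(ℝ, E) x) : d% (b.app Y Z) x v =
        b x (D Y x v) (Z x) + a x (endDeriv D hT x (Y x) v) (Z x) + b x (Y x) (D Z x v) := by
    have h : b.app Y Z = a.app (T.app Y) Z := by ext y; exact (hab y _ _).symm
    rw [h, ha x _ _ (hT hY) hZ, apply_app hT hY]
    simp [EndField.app, hab]
  simp only [FormField.extDeriv, br hX hY, br hY hZ, br hZ hX, der hX hY, der hY hZ, der hZ hX,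
    map_sub, sub_apply]
  rw [skew x (Y x) (D Z x (X x)), skew x (Z x) (D X x (Y x)), skew x (X x) (D Y x (Z x))]
  ring

/-! ### Connections preserving a metric and an associated form -/

theorem commutesWith_recursionOperator {D : AffineConnection E M} {a b : FormField E M}
    (ha : a.IsNondegenerate) (hT : (recursionOperator a b).IsDifferentiable)
    (hDa : Preserves D a) (hDb : Preserves D b) : CommutesWith D (recursionOperator a b) := by
  intro x Y hY v
  refine ha.ext fun w ↦ ?_
  obtain ⟨W, hW, rfl⟩ := exists_vecField w
  have h1 := hDa x _ W (hT hY) hW v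
  have h2 := hDb x Y W hY hW v
  have h3 : a.app ((recursionOperator a b).app Y) W = b.app Y W := by
    ext y; exact recursionOperator_spec ha b y _ _
  rw [h3, h2] at h1
  simp only [EndField.app, recursionOperator_spec ha] at h1 ⊢
  linear_combination -h1

theorem preserves_of_commutesWith {D : AffineConnection E M} {a b : FormField E M}
    {T : EndField E M} (hT : T.IsDifferentiable) (hab : ∀ x u v, a x (T x u) v = b x u v)
    (hDa : Preserves D a) (hDT : CommutesWith D T) : Preserves D b := by
  intro x Y Z hY hZ v
  have h : b.app Y Z = a.app (T.app Y) Z := by ext y; exact (hab y _ _).symm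
  rw [h, hDa x _ _ (hT hY) hZ, hDT x Y hY]
  simp [EndField.app, hab]

theorem CommutesWith.preservesDistribution_eigenbundle {D : AffineConnection E M}
    {T : EndField E M} (hDT : CommutesWith D T) (c : ℝ) :
    PreservesDistribution D (T.eigenbundle c) := by
  intro x Y hY hYc v
  have h : T.app Y = c • Y := by
    ext y; exact Module.End.mem_eigenspace_iff.1 (hYc y)
  refine Module.End.mem_eigenspace_iff.2 ?_
  have h' := hDT x Y hY v
  rw [h, map_const_smul D c hY] at h'
  exact h'.symm

/-- The fields `Y + TY` and `Y - TY` are sections of the two eigenbundles, so the action of `T` on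
their derivatives is known. -/
theorem commutesWith_of_preservesDistribution {D : AffineConnection E M} {T : EndField E M}
    (hT : T.IsDifferentiable) (hTT : ∀ x u, T x (T x u) = u)
    (h₁ : PreservesDistribution D (T.eigenbundle 1))
    (h₂ : PreservesDistribution D (T.eigenbundle (-1))) : CommutesWith D T := by
  intro x Y hY v
  have d₁ := mdifferentiableAt_add_section hY (hT hY)
  have d₂ := mdifferentiableAt_sub_section hY (hT hY)
  have e₁ : T x (D (Y + T.app Y) x v) = (1 : ℝ) • D (Y + T.app Y) x v :=
    Module.End.mem_eigenspace_iff.1 (h₁ x _ d₁ (fun y ↦ Module.End.mem_eigenspace_iff.2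
      (by simp [EndField.app, hTT, add_comm])) v)
  have e₂ : T x (D (Y - T.app Y) x v) = (-1 : ℝ) • D (Y - T.app Y) x v :=
    Module.End.mem_eigenspace_iff.1 (h₂ x _ d₂ (fun y ↦ Module.End.mem_eigenspace_iff.2
      (by simp [EndField.app, hTT])) v)
  have hsub : D (Y - T.app Y) x = D Y x - D (T.app Y) x :=
    eq_sub_of_add_eq (by rw [← map_add D d₂ (hT hY), sub_add_cancel])
  rw [map_add D hY (hT hY)] at e₁
  rw [hsub] at e₂
  simp only [add_apply, sub_apply, _root_.map_add, map_sub] at e₁ e₂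
  have : (2 : ℝ) • D (T.app Y) x v = (2 : ℝ) • T x (D Y x v) := by
    linear_combination (norm := module) - e₁ - e₂
  exact smul_right_injective _ two_ne_zero this

end

/-! ## The connections of a Born structure -/

section

variable {E : Type*} [NormedAddCommGroup E] [NormedSpace ℝ E]
  {M : Type*} [TopologicalSpace M] [ChartedSpace E M] [IsManifold 𝓘(ℝ, E) ∞ M]
  [FiniteDimensional ℝ E]

open AffineConnection

namespace BornStructure

variable (S : BornStructure E M)

/-! ### The algebra of the recursion operators -/

theorem g_A (x : M) (u v : TangentSpace 𝓘(ℝ, E) x) : S.g x (S.A x u) v = S.Ω x u v :=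
  recursionOperator_spec S.isPseudoRiemannian_g.nondegenerate S.Ω x u v

theorem g_B (x : M) (u v : TangentSpace 𝓘(ℝ, E) x) : S.g x (S.B x u) v = S.h x u v :=
  recursionOperator_spec S.isPseudoRiemannian_g.nondegenerate S.h x u v

theorem A_A (x : M) (u : TangentSpace 𝓘(ℝ, E) x) : S.A x (S.A x u) = u := S.A_sq x u

theorem B_B (x : M) (u : TangentSpace 𝓘(ℝ, E) x) : S.B x (S.B x u) = u := S.B_sq x u

theorem J_J (x : M) (u : TangentSpace 𝓘(ℝ, E) x) : S.J x (S.J x u) = (-1 : ℝ) • u := by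
  rw [neg_one_smul]; exact S.J_sq x u

theorem g_A_left (x : M) (u v : TangentSpace 𝓘(ℝ, E) x) :
    S.g x (S.A x u) v = -S.g x u (S.A x v) := by
  rw [S.isPseudoRiemannian_g.symm x u, g_A, g_A, S.isNondegenerateTwoForm_Ω.skew]

theorem g_B_left (x : M) (u v : TangentSpace 𝓘(ℝ, E) x) :
    S.g x (S.B x u) v = S.g x u (S.B x v) := by
  rw [S.isPseudoRiemannian_g.symm x u, g_B, g_B, S.isPseudoRiemannian_h.symm]

theorem J_eq_neg_A_B (x : M) (u : TangentSpace 𝓘(ℝ, E) x) : S.J x u = -S.A x (S.B x u) := by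
  refine neg_injective (S.isNondegenerateTwoForm_Ω.nondegenerate.ext fun w ↦ ?_)
  have h : S.Ω x (-S.J x u) w = S.h x u w := by
    have hJ : -S.J x u = recursionOperator S.Ω S.h x u := neg_neg _
    rw [hJ]
    exact recursionOperator_spec S.isNondegenerateTwoForm_Ω.nondegenerate S.h x u w
  rw [h, neg_neg, ← g_A, A_A, g_B]

/-- Since `J = -AB`, this is `J² = -Id` evaluated at `BAu`. -/
theorem A_B (x : M) (u : TangentSpace 𝓘(ℝ, E) x) : S.A x (S.B x u) = -S.B x (S.A x u) := by
  have h := S.J_J x (S.B x (S.A x u))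
  simp only [J_eq_neg_A_B, map_neg, neg_neg, B_B, A_A, neg_one_smul] at h
  exact h

theorem J_eq_B_A (x : M) (u : TangentSpace 𝓘(ℝ, E) x) : S.J x u = S.B x (S.A x u) := by
  rw [J_eq_neg_A_B, A_B, neg_neg]

theorem isDifferentiable_A : S.A.IsDifferentiable := fun _ _ hX ↦
  mdifferentiableAt_recursionOperator_app S.isPseudoRiemannian_g.nondegenerate
    S.isPseudoRiemannian_g.smooth S.isNondegenerateTwoForm_Ω.smooth hX

theorem isDifferentiable_B : S.B.IsDifferentiable := fun _ _ hX ↦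
  mdifferentiableAt_recursionOperator_app S.isPseudoRiemannian_g.nondegenerate
    S.isPseudoRiemannian_g.smooth S.isPseudoRiemannian_h.smooth hX

theorem isDifferentiable_J : S.J.IsDifferentiable := fun x X hX ↦ by
  have h : S.J.app X = S.B.app (S.A.app X) := by ext y; exact S.J_eq_B_A y _
  rw [h]
  exact S.isDifferentiable_B (S.isDifferentiable_A hX)

variable {S}

/-- In an integrable Born structure, `A` and `B` are integrable. -/
theorem IsIntegrable.isIntegrable_A_B (hS : S.IsIntegrable) :
    S.A.IsIntegrable ∧ S.B.IsIntegrable := by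
  have hA (x : M) u : S.A x (S.A x u) = (1 : ℝ) • u := by rw [A_A, one_smul]
  have hB (x : M) u : S.B x (S.B x u) = (1 : ℝ) • u := by rw [B_B, one_smul]
  obtain ⟨-, h | ⟨iA, iJ⟩ | ⟨iB, iJ⟩⟩ := hS
  · exact h
  -- Here `B = JA`, and in the last case `A = BJ`; in both, `pq = -1`.
  · refine ⟨iA, EndField.isIntegrable_comp S.J_J hA (fun x u ↦ ?_) S.isDifferentiable_J
      S.isDifferentiable_A iJ iA (by norm_num) fun x u ↦ ?_⟩
    · simp [J_eq_neg_A_B, A_A, A_B]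
    · simp [J_eq_B_A, A_A]
  · refine ⟨EndField.isIntegrable_comp hB S.J_J (fun x u ↦ ?_) S.isDifferentiable_B
      S.isDifferentiable_J iB iJ (by norm_num) fun x u ↦ ?_, iB⟩
    · simp [J_eq_neg_A_B, B_B, A_B]
    · simp [J_eq_B_A, B_B]

/-! ### The Künneth connection -/

/-- The Levi-Civita connection of an integrable Born structure commutes with `A`. -/
theorem IsIntegrable.commutesWith_A (hS : S.IsIntegrable) {D : AffineConnection E M}
    (hD : IsLeviCivita S.g D) : CommutesWith D S.A := by
  have dA := S.isDifferentiable_A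
  rw [commutesWith_iff dA]
  intro x
  have adj (u v w : TangentSpace 𝓘(ℝ, E) x) :=
    endDeriv_adjoint dA hD.preserves S.isPseudoRiemannian_g.smooth (δ := -1)
      (fun x u v ↦ by rw [g_A_left, neg_one_mul]) x u v w
  have hsq (x : M) u : S.A x (S.A x u) = (1 : ℝ) • u := by rw [A_A, one_smul]
  have key := trilinear_eq_zero_of_closed
    (α := fun v u w ↦ S.g x (endDeriv D dA x u v) w) (S.A_A x)
    (fun v u w ↦ by rw [adj, S.isPseudoRiemannian_g.symm, neg_one_mul])
    (fun v u w ↦ by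
      rw [endDeriv_app dA hsq, map_neg, neg_apply, g_A_left, neg_neg])
    (fun u v w ↦ by
      obtain ⟨U, hU, rfl⟩ := exists_vecField u
      obtain ⟨V, hV, rfl⟩ := exists_vecField v
      obtain ⟨W, hW, rfl⟩ := exists_vecField w
      rw [← extDeriv_eq hD.torsion_eq_zero dA hD.preserves S.g_A S.isNondegenerateTwoForm_Ω.skew
        hU hV hW]
      exact hS.1 x U V W hU hV hW)
    (fun u v w ↦ by
      have h := congrArg (fun z ↦ S.g x z w)
        (endDeriv_of_isIntegrable hD.torsion_eq_zero dA hS.isIntegrable_A_B.1 x u v)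
      simp only [map_sub, _root_.map_add, sub_apply, add_apply, g_A_left, map_zero,
        zero_apply] at h
      linear_combination h)
  intro u v
  exact S.isPseudoRiemannian_g.nondegenerate x _ fun w ↦ key v u w

theorem isKunneth_of_commutesWith_A {D : AffineConnection E M} (hD : IsLeviCivita S.g D)
    (hA : CommutesWith D S.A) : S.IsKunneth D where
  preserves_F := hA.preservesDistribution_eigenbundle 1
  preserves_G := hA.preservesDistribution_eigenbundle (-1)
  preserves_Ω := preserves_of_commutesWith S.isDifferentiable_A S.g_A hD.preserves hA
  mixed_torsion x u _ v _ := ⟨hD.torsion_eq_zero x u v, hD.torsion_eq_zero x v u⟩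

end BornStructure

/-! ### The difference tensor of two connections -/

theorem difference_apply (D D' : AffineConnection E M) {x : M} {Y : VecField E M}
    (hY : MDiffAt (T% Y) x) (v : TangentSpace 𝓘(ℝ, E) x) :
    D Y x v = D' Y x v + D.difference D' x (Y x) v := by
  rw [CovariantDerivative.difference, IsCovariantDerivativeOn.difference_apply _ _ (by trivial) hY]
  simp

theorem difference_app {D D' : AffineConnection E M} {T : EndField E M}
    (hT : T.IsDifferentiable) (h : CommutesWith D T) (h' : CommutesWith D' T) (x : M)
    (u v : TangentSpace 𝓘(ℝ, E) x) :
    D.difference D' x (T x u) v = T x (D.difference D' x u v) := by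
  obtain ⟨U, hU, rfl⟩ := exists_vecField u
  have h1 := h x U hU v
  rw [difference_apply D D' hU, difference_apply D D' (hT hU), h' x U hU, _root_.map_add] at h1
  exact add_left_cancel h1

theorem difference_skew {D D' : AffineConnection E M} {b : FormField E M} (h : Preserves D b)
    (h' : Preserves D' b) (x : M) (u w v : TangentSpace 𝓘(ℝ, E) x) :
    b x (D.difference D' x u v) w + b x u (D.difference D' x w v) = 0 := by
  obtain ⟨U, hU, rfl⟩ := exists_vecField u
  obtain ⟨W, hW, rfl⟩ := exists_vecField w
  have h1 := h x U W hU hW v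
  rw [h' x U W hU hW v, difference_apply D D' hU, difference_apply D D' hW] at h1
  simp only [_root_.map_add, add_apply] at h1
  linear_combination -h1

theorem difference_torsion (D D' : AffineConnection E M) (x : M)
    (u v : TangentSpace 𝓘(ℝ, E) x) : D.torsion x u v = D'.torsion x u v +
      (D.difference D' x v u - D.difference D' x u v) := by
  obtain ⟨U, hU, rfl⟩ := exists_vecField u
  obtain ⟨V, hV, rfl⟩ := exists_vecField v
  rw [D.torsion_apply hU hV, D'.torsion_apply hU hV, difference_apply D D' hU,
    difference_apply D D' hV]
  abel

namespace BornStructure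

variable {S : BornStructure E M}

/-- The Künneth connection is unique. -/
theorem IsKunneth.unique {D D' : AffineConnection E M} (h : S.IsKunneth D)
    (h' : S.IsKunneth D') {x : M} {Y : VecField E M} (hY : MDiffAt (T% Y) x) :
    D Y x = D' Y x := by
  have dA := S.isDifferentiable_A
  have cA := commutesWith_of_preservesDistribution dA S.A_A h.preserves_F h.preserves_G
  have cA' := commutesWith_of_preservesDistribution dA S.A_A h'.preserves_F h'.preserves_G
  set C := D.difference D' x with hC
  have CA := difference_app dA cA cA' x
  rw [← hC] at CA
  have hΩ (u v : TangentSpace 𝓘(ℝ, E) x) : S.Ω x (S.A x u) v = -S.Ω x u (S.A x v) := by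
    rw [← g_A, ← g_A, g_A_left]
  have key := trilinear_eq_zero_of_mixed (s := fun v u w ↦ S.Ω x (C u v) w) (S.A_A x)
    -- `C` is skew for the skew form `Ω`, so `Ω(C·,·)` is symmetric.
    (fun v u w ↦ by
      rw [S.isNondegenerateTwoForm_Ω.skew x (C w v) u]
      exact eq_neg_of_add_eq_zero_left (difference_skew h.preserves_Ω h'.preserves_Ω x u w v))
    (fun v u w ↦ by rw [CA, hΩ])
    (fun u v w ↦ by
      -- Up to a factor `2` these are the projections of `u` and `v` to `L₊` and `L₋`, so the mixed
      -- torsion condition becomes an identity in arbitrary `u` and `v`.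
      have mu : u + S.A x u ∈ S.L 1 x := Module.End.mem_eigenspace_iff.2
        (by simp [A_A, add_comm])
      have mv : v - S.A x v ∈ S.L (-1) x := Module.End.mem_eigenspace_iff.2 (by simp [A_A])
      have e := difference_torsion D D' x (u + S.A x u) (v - S.A x v)
      rw [(h.mixed_torsion x _ mu _ mv).1, (h'.mixed_torsion x _ mu _ mv).1, ← hC] at e
      have e' := congrArg (fun z ↦ S.Ω x z w) e
      simp only [map_sub, _root_.map_add, sub_apply, add_apply, map_zero, zero_apply] at e'
      linear_combination -e')
  ext v
  rw [difference_apply D D' hY, S.isNondegenerateTwoForm_Ω.nondegenerate x _ (key v (Y x)), add_zero]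

/-! ### The Born connection -/

/-- The average of a connection under conjugation with `B`. -/
def averageB (S : BornStructure E M) (D : AffineConnection E M) : AffineConnection E M where
  toFun Y x := (1 / 2 : ℝ) • (D Y x + S.B x ∘L D (S.B.app Y) x)
  isCovariantDerivativeOnUniv :=
  { add := by
      intro Y Y' x hY hY' _
      ext v
      simp only [EndField.app_add, AffineConnection.map_add D hY hY',
        AffineConnection.map_add D (S.isDifferentiable_B hY) (S.isDifferentiable_B hY')]
      simp
      module
    leibniz := by
      intro Y f x hY hf _
      ext v
      simp only [EndField.app_smul, AffineConnection.map_smul D hf hY,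
        AffineConnection.map_smul D hf (S.isDifferentiable_B hY)]
      -- Both halves contribute the same `df` term, because `B(BY) = Y`.
      simp [EndField.app, B_B]
      module }

theorem averageB_eq (D : AffineConnection E M) (Y : VecField E M)
    (x : M) (v : TangentSpace 𝓘(ℝ, E) x) : S.averageB D Y x v =
      (1 / 2 : ℝ) • (D Y x v + S.B x (D (S.B.app Y) x v)) := rfl

theorem averageB_apply (D : AffineConnection E M) {x : M} {Y : VecField E M}
    (hY : MDiffAt (T% Y) x) (v : TangentSpace 𝓘(ℝ, E) x) : S.averageB D Y x v =
      D Y x v + (1 / 2 : ℝ) • S.B x (endDeriv D S.isDifferentiable_B x (Y x) v) := by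
  rw [averageB_eq, apply_app S.isDifferentiable_B hY, _root_.map_add, B_B]
  module

end BornStructure

end

section

variable {E : Type*} [NormedAddCommGroup E] [NormedSpace ℝ E]
  {M : Type*} [TopologicalSpace M] [ChartedSpace E M] [IsManifold 𝓘(ℝ, E) ∞ M]
  [FiniteDimensional ℝ E]

open AffineConnection

namespace BornStructure

variable {S : BornStructure E M}

/-- `D_v B` is `g`-self-adjoint and anticommutes with the self-adjoint `B`, so `B(D_v B)` is
`g`-skew. This is why averaging keeps `g` parallel. -/
theorem endDeriv_B_adjoint {D : AffineConnection E M} (hD : Preserves D S.g) (x : M)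
    (u v w : TangentSpace 𝓘(ℝ, E) x) :
    S.g x (S.B x (endDeriv D S.isDifferentiable_B x u v)) w =
      -S.g x (S.B x (endDeriv D S.isDifferentiable_B x w v)) u := by
  have adj := endDeriv_adjoint S.isDifferentiable_B hD S.isPseudoRiemannian_g.smooth (δ := 1)
      (fun x u v ↦ by rw [g_B_left, one_mul]) x u v (S.B x w)
  rw [g_B_left, adj, endDeriv_app S.isDifferentiable_B (c := 1) (by simp [B_B]), one_mul, map_neg,
    S.isPseudoRiemannian_g.symm]

theorem endDeriv_B_app (D : AffineConnection E M) (x : M) (u v : TangentSpace 𝓘(ℝ, E) x) :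
    endDeriv D S.isDifferentiable_B x (S.B x u) v =
      -S.B x (endDeriv D S.isDifferentiable_B x u v) :=
  endDeriv_app S.isDifferentiable_B (c := 1) (by simp [B_B]) x u v

theorem preserves_g_averageB {D : AffineConnection E M} (hD : Preserves D S.g) :
    Preserves (S.averageB D) S.g := by
  intro x Y Z hY hZ v
  rw [hD x Y Z hY hZ v, averageB_apply D hY, averageB_apply D hZ]
  simp only [_root_.map_add, add_apply, _root_.map_smul, smul_apply, smul_eq_mul]
  rw [endDeriv_B_adjoint hD, S.isPseudoRiemannian_g.symm x (Y x) (S.B x _)]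
  ring

theorem commutesWith_B_averageB (D : AffineConnection E M) : CommutesWith (S.averageB D) S.B := by
  intro x Y hY v
  have h : S.B.app (S.B.app Y) = Y := by ext y; exact S.B_B y _
  rw [averageB_eq, averageB_eq, h, _root_.map_smul, _root_.map_add, B_B, add_comm]

/-- Passing `A` through both factors `B` of `B D B` produces two signs, which cancel. -/
theorem commutesWith_A_averageB {D : AffineConnection E M} (hD : CommutesWith D S.A) :
    CommutesWith (S.averageB D) S.A := by
  intro x Y hY v
  have h : S.B.app (S.A.app Y) = (-1 : ℝ) • S.A.app (S.B.app Y) := by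
    ext y; simp [EndField.app, A_B]
  rw [averageB_eq, averageB_eq, h,
    map_const_smul D _ (S.isDifferentiable_A (S.isDifferentiable_B hY)), hD x Y hY, smul_apply,
    hD x _ (S.isDifferentiable_B hY), _root_.map_smul, _root_.map_smul, _root_.map_add, A_B]
  module

theorem average_eq {D : AffineConnection E M} (hD : CommutesWith D S.A) {x : M}
    {Y : VecField E M} (hY : MDiffAt (T% Y) x) (v : TangentSpace 𝓘(ℝ, E) x) :
    average S.A D Y x v = D Y x v := by
  rw [average, hD x Y hY, A_A]
  module

/-- Half of this cyclic sum is the generalized torsion of `averageB` minus that of `D`. -/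
theorem IsIntegrable.cyclic_endDeriv_B (hS : S.IsIntegrable) {D : AffineConnection E M}
    (hD : IsLeviCivita S.g D) (x : M) (u v w : TangentSpace 𝓘(ℝ, E) x) :
    S.g x (S.B x (endDeriv D S.isDifferentiable_B x v u)) w
      + S.g x (S.B x (endDeriv D S.isDifferentiable_B x w v)) u
      + S.g x (S.B x (endDeriv D S.isDifferentiable_B x u w)) v = 0 :=
  trilinear_cyclic_eq_zero (B := S.B x)
    (c := fun v u w ↦ S.g x (S.B x (endDeriv D S.isDifferentiable_B x u v)) w)
    (fun v u w ↦ endDeriv_B_adjoint hD.preserves x u v w)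
    (fun v u w ↦ by rw [endDeriv_B_app, map_neg, map_neg, neg_apply, g_B_left])
    (fun u v w ↦ by
      have h := congrArg (fun z ↦ S.g x z w) (endDeriv_of_isIntegrable hD.torsion_eq_zero
        S.isDifferentiable_B hS.isIntegrable_A_B.2 x u v)
      simp only [map_sub, _root_.map_add, sub_apply, add_apply, map_zero, zero_apply] at h
      rw [S.g_B_left x _ (S.B x w), S.g_B_left x _ (S.B x w), B_B]
      exact h) u v w

theorem IsIntegrable.hasVanishingGeneralizedTorsion_averageB (hS : S.IsIntegrable)
    {D : AffineConnection E M} (hD : IsLeviCivita S.g D) :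
    HasVanishingGeneralizedTorsion S.g S.A D (S.averageB D) := by
  intro x X Y Z hX hY hZ
  have hA := hS.commutesWith_A hD
  have cyc := hS.cyclic_endDeriv_B hD x (X x) (Y x) (Z x)
  rw [endDeriv_B_adjoint hD.preserves x (Z x)] at cyc
  rw [average_eq hA hX, average_eq hA hY, average_eq hA hX, averageB_apply D hX,
    averageB_apply D hY, averageB_apply D hX]
  simp only [map_sub, sub_apply, _root_.map_add, add_apply, _root_.map_smul, smul_apply,
    smul_eq_mul]
  linear_combination (1 / 2 : ℝ) * cyc

theorem IsIntegrable.isBorn_averageB (hS : S.IsIntegrable) {D : AffineConnection E M}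
    (hD : IsLeviCivita S.g D) : S.IsBorn (S.averageB D) where
  preserves_g := preserves_g_averageB hD.preserves
  preserves_h := preserves_of_commutesWith S.isDifferentiable_B S.g_B
    (preserves_g_averageB hD.preserves) (commutesWith_B_averageB D)
  preserves_Ω := preserves_of_commutesWith S.isDifferentiable_A S.g_A
    (preserves_g_averageB hD.preserves) (commutesWith_A_averageB (hS.commutesWith_A hD))
  generalized_torsion := ⟨D, hD, hS.hasVanishingGeneralizedTorsion_averageB hD⟩

/-- The Born connection of an integrable Born structure is an averaged Levi-Civita connection. -/
theorem IsIntegrable.eq_averageB (hS : S.IsIntegrable) {DB : AffineConnection E M}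
    (hDB : S.IsBorn DB) : ∃ D : AffineConnection E M, IsLeviCivita S.g D ∧
      ∀ {x : M} {Y : VecField E M}, MDiffAt (T% Y) x → DB Y x = S.averageB D Y x := by
  -- Averaging the very `D` that witnesses the Born condition lets the two generalized torsions be
  -- compared directly.
  obtain ⟨D, hD, tor⟩ := hDB.generalized_torsion
  refine ⟨D, hD, fun {x Y} hY ↦ ?_⟩
  have hA := hS.commutesWith_A hD
  have hg := S.isPseudoRiemannian_g.nondegenerate
  set C := DB.difference (S.averageB D) x with hC
  have skew := difference_skew hDB.preserves_g (preserves_g_averageB hD.preserves) x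
  have CA := difference_app S.isDifferentiable_A (commutesWith_recursionOperator hg
    S.isDifferentiable_A hDB.preserves_g hDB.preserves_Ω) (commutesWith_A_averageB hA) x
  have CB := difference_app S.isDifferentiable_B (commutesWith_recursionOperator hg
    S.isDifferentiable_B hDB.preserves_g hDB.preserves_h) (commutesWith_B_averageB D) x
  rw [← hC] at skew CA CB
  have key := trilinear_eq_zero_of_cyclic (s := fun v u w ↦ S.g x (C u v) w) (S.A_A x) (S.B_B x)
    (fun v u w ↦ by simp [A_B])
    (fun v u w ↦ by rw [CA, g_A_left])
    (fun v u w ↦ by rw [CB, g_B_left])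
    -- Equal generalized torsions, together with the `g`-skewness of `C`, say that the cyclic sum of
    -- `g(C·,·)` vanishes.
    (fun u v w ↦ by
      obtain ⟨U, hU, rfl⟩ := exists_vecField u
      obtain ⟨V, hV, rfl⟩ := exists_vecField v
      obtain ⟨W, hW, rfl⟩ := exists_vecField w
      have e := (tor x U V W hU hV hW).trans
        (hS.hasVanishingGeneralizedTorsion_averageB hD x U V W hU hV hW).symm
      rw [difference_apply DB (S.averageB D) hU, difference_apply DB (S.averageB D) hV,
        difference_apply DB (S.averageB D) hU, ← hC] at e
      have sk := skew (W x) (U x) (V x)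
      rw [S.isPseudoRiemannian_g.symm x (W x)] at sk
      simp only [map_sub, sub_apply, _root_.map_add, add_apply] at e
      linear_combination e + sk)
  ext v
  rw [difference_apply DB (S.averageB D) hY, hg x _ (key v (Y x)), add_zero]

/-! ### The torsion of the Born connection -/

theorem torsion_eq_of_eq_averageB {D DB : AffineConnection E M}
    (hD : ∀ x u v, D.torsion x u v = 0)
    (h : ∀ {x : M} {Y : VecField E M}, MDiffAt (T% Y) x → DB Y x = S.averageB D Y x)
    (x : M) (u v : TangentSpace 𝓘(ℝ, E) x) :
    DB.torsion x u v = (1 / 2 : ℝ) • (S.B x (endDeriv D S.isDifferentiable_B x v u)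
      - S.B x (endDeriv D S.isDifferentiable_B x u v)) := by
  obtain ⟨U, hU, rfl⟩ := exists_vecField u
  obtain ⟨V, hV, rfl⟩ := exists_vecField v
  have h0 := D.torsion_apply hU hV
  rw [hD] at h0
  rw [DB.torsion_apply hU hV, h hU, h hV, averageB_apply D hU, averageB_apply D hV]
  linear_combination (norm := module) -h0

theorem πPlus_apply (S : BornStructure E M) (x : M) (u : TangentSpace 𝓘(ℝ, E) x) :
    S.πPlus x u = (1 / 2 : ℝ) • (u + S.B x u) := by
  have hp : (1 / 2 : ℝ) • (u + S.B x u) ∈ S.B.eigenbundle 1 x :=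
    Module.End.mem_eigenspace_iff.2 (by simp [B_B, add_comm])
  have hm : (1 / 2 : ℝ) • (u - S.B x u) ∈ S.B.eigenbundle (-1) x :=
    Module.End.mem_eigenspace_iff.2 (by simp [B_B, ← smul_neg])
  have hu : u = (1 / 2 : ℝ) • (u + S.B x u) + (1 / 2 : ℝ) • (u - S.B x u) := by module
  conv_lhs => rw [hu]
  rw [πPlus, _root_.map_add, Submodule.projection_apply_of_mem_left _ hp,
    Submodule.projection_apply_of_mem_right _ hm, add_zero]

theorem πMinus_apply (S : BornStructure E M) (x : M) (u : TangentSpace 𝓘(ℝ, E) x) :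
    S.πMinus x u = (1 / 2 : ℝ) • (u - S.B x u) := by
  have hp : (1 / 2 : ℝ) • (u + S.B x u) ∈ S.B.eigenbundle 1 x :=
    Module.End.mem_eigenspace_iff.2 (by simp [B_B, add_comm])
  have hm : (1 / 2 : ℝ) • (u - S.B x u) ∈ S.B.eigenbundle (-1) x :=
    Module.End.mem_eigenspace_iff.2 (by simp [B_B, ← smul_neg])
  have hu : u = (1 / 2 : ℝ) • (u + S.B x u) + (1 / 2 : ℝ) • (u - S.B x u) := by module
  conv_lhs => rw [hu]
  rw [πMinus, _root_.map_add, Submodule.projection_apply_of_mem_right _ hp,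
    Submodule.projection_apply_of_mem_left _ hm, zero_add]

/-- If the skew part of `B (D B)` vanishes, then `D B = 0`. -/
theorem endDeriv_B_eq_zero {D : AffineConnection E M} (hD : Preserves D S.g) {x : M}
    (h : ∀ u v, S.B x (endDeriv D S.isDifferentiable_B x v u) =
      S.B x (endDeriv D S.isDifferentiable_B x u v)) (u v : TangentSpace 𝓘(ℝ, E) x) :
    endDeriv D S.isDifferentiable_B x u v = 0 := by
  rw [← S.B_B x (endDeriv D S.isDifferentiable_B x u v)]
  have key : S.B x (endDeriv D S.isDifferentiable_B x u v) = 0 :=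
    S.isPseudoRiemannian_g.nondegenerate x _ fun w ↦ by
      -- A trilinear form symmetric in one pair of slots and skew in an overlapping pair is zero.
      have h1 := endDeriv_B_adjoint (S := S) hD x u v w
      have h2 := endDeriv_B_adjoint (S := S) hD x v w u
      have h3 := endDeriv_B_adjoint (S := S) hD x w u v
      rw [h v w] at h1
      rw [h w u] at h2
      rw [h u v] at h3
      linarith
  rw [key, map_zero]

/-- If `Bu = εu` and `Bv = εv`, anticommutation gives `ε(∇_u B)v = -B(∇_u B)v`, and likewise with
`u, v` exchanged. Then `N_B(u,v) = -4 T^B(u,v)`, whence the factor `-1/4`. -/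
theorem IsIntegrable.torsion_eq_zero_of_same_eigenbundle (hS : S.IsIntegrable)
    {DB : AffineConnection E M} (hDB : S.IsBorn DB) (x : M) (u v : TangentSpace 𝓘(ℝ, E) x)
    (huv : (S.B x u = u ∧ S.B x v = v) ∨ (S.B x u = -u ∧ S.B x v = -v)) :
    DB.torsion x u v = 0 := by
  obtain ⟨D, hD, h⟩ := hS.eq_averageB hDB
  have n := endDeriv_of_isIntegrable hD.torsion_eq_zero S.isDifferentiable_B
    hS.isIntegrable_A_B.2 x u v
  have e₁ := endDeriv_B_app (S := S) D x u v
  have e₂ := endDeriv_B_app (S := S) D x v u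
  rw [torsion_eq_of_eq_averageB hD.torsion_eq_zero h]
  rcases huv with ⟨hu, hv⟩ | ⟨hu, hv⟩
  · rw [hu] at n e₁
    rw [hv] at n e₂
    linear_combination (norm := module) (-1 / 4 : ℝ) • n + (1 / 4 : ℝ) • e₂ - (1 / 4 : ℝ) • e₁
  · rw [hu] at n e₁
    rw [hv] at n e₂
    simp only [map_neg, neg_apply] at n e₁ e₂
    linear_combination (norm := module) (-1 / 4 : ℝ) • n + (1 / 4 : ℝ) • e₂ - (1 / 4 : ℝ) • e₁

/-- On such fields averaging is projection: `∇ᴮ_X Y = π₋(∇_X Y)` and `∇ᴮ_Y X = π₊(∇_Y X)`.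
Subtracting `[X,Y] = ∇_X Y - ∇_Y X` leaves the complementary projections. -/
theorem IsIntegrable.torsion_mixed (hS : S.IsIntegrable) {DK DB : AffineConnection E M}
    (hDK : S.IsKunneth DK) (hDB : S.IsBorn DB) {x : M} {X Y : VecField E M}
    (hX : MDiffAt (T% X) x) (hY : MDiffAt (T% Y) x) (hBX : ∀ y, S.B y (X y) = X y)
    (hBY : ∀ y, S.B y (Y y) = -Y y) : DB.torsion x (X x) (Y x) =
      -((1 / 2 : ℝ) • (DK Y x (X x) + S.B x (DK Y x (X x))))
        + (1 / 2 : ℝ) • (DK X x (Y x) - S.B x (DK X x (Y x))) := by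
  obtain ⟨D, hD, h⟩ := hS.eq_averageB hDB
  have hK := isKunneth_of_commutesWith_A hD (hS.commutesWith_A hD)
  have eX : S.B.app X = X := funext hBX
  have eY : S.B.app Y = (-1 : ℝ) • Y := by ext y; simp [EndField.app, hBY]
  have h0 := D.torsion_apply hX hY
  rw [hD.torsion_eq_zero] at h0
  rw [DB.torsion_apply hX hY, h hX, h hY, averageB_eq, averageB_eq, eX, eY,
    map_const_smul D _ hY, hDK.unique hK hX, hDK.unique hK hY, smul_apply, _root_.map_smul]
  linear_combination (norm := module) -h0

theorem IsIntegrable.torsion_eq_zero_iff (hS : S.IsIntegrable) {DK DB : AffineConnection E M}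
    (hDK : S.IsKunneth DK) (hDB : S.IsBorn DB) :
    (∀ (x : M) (u v : TangentSpace 𝓘(ℝ, E) x), DB.torsion x u v = 0) ↔ CommutesWith DK S.B := by
  obtain ⟨D, hD, h⟩ := hS.eq_averageB hDB
  have hK := isKunneth_of_commutesWith_A hD (hS.commutesWith_A hD)
  have hcomm : CommutesWith DK S.B ↔ CommutesWith D S.B := by
    refine forall₃_congr fun x Y hY ↦ ?_
    rw [hDK.unique hK hY, hDK.unique hK (S.isDifferentiable_B hY)]
  rw [hcomm, commutesWith_iff S.isDifferentiable_B]
  simp only [torsion_eq_of_eq_averageB hD.torsion_eq_zero h]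
  constructor
  · intro ht x
    refine endDeriv_B_eq_zero hD.preserves fun u v ↦ ?_
    have := ht x u v
    rw [smul_eq_zero, sub_eq_zero] at this
    exact this.resolve_left (by norm_num)
  · intro hc x u v
    simp [hc]

end BornStructure

end

end BornGeometry

end

theorem mainTheorem4 {E : Type*} [NormedAddCommGroup E] [NormedSpace ℝ E] [FiniteDimensional ℝ E]
    {M : Type*} [TopologicalSpace M] [ChartedSpace E M] [IsManifold 𝓘(ℝ, E) ∞ M]
    (S : BornGeometry.BornStructure E M) (hS : S.IsIntegrable) :
    -- the Künneth connection and the Born connection exist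
    (∃ DK : BornGeometry.AffineConnection E M, S.IsKunneth DK) ∧
    (∃ DB : BornGeometry.AffineConnection E M, S.IsBorn DB) ∧
    -- the torsion of the Born connection
    ∀ DK DB : BornGeometry.AffineConnection E M, S.IsKunneth DK → S.IsBorn DB →
      (∀ (x : M) (u v : TangentSpace 𝓘(ℝ, E) x),
        (S.B x u = u ∧ S.B x v = v) ∨ (S.B x u = -u ∧ S.B x v = -v) → DB.torsion x u v = 0) ∧
      (∀ (x : M) (X Y : BornGeometry.VecField E M), MDiffAt (T% X) x → MDiffAt (T% Y) x →
        (∀ y, S.B y (X y) = X y) → (∀ y, S.B y (Y y) = -Y y) →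
          DB.torsion x (X x) (Y x) =
            -((1 / 2 : ℝ) • (DK Y x (X x) + S.B x (DK Y x (X x))))
              + (1 / 2 : ℝ) • (DK X x (Y x) - S.B x (DK X x (Y x))) ∧
          DB.torsion x (X x) (Y x) =
            -S.πPlus x (DK Y x (X x)) + S.πMinus x (DK X x (Y x))) ∧
      ((∀ (x : M) (u v : TangentSpace 𝓘(ℝ, E) x), DB.torsion x u v = 0) ↔
        BornGeometry.CommutesWith DK S.B) := by
  have hD := BornGeometry.isLeviCivita_leviCivita S.isPseudoRiemannian_g
  refine ⟨⟨_, BornGeometry.BornStructure.isKunneth_of_commutesWith_A hD (hS.commutesWith_A hD)⟩,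
    ⟨_, hS.isBorn_averageB hD⟩, fun DK DB hDK hDB ↦
    ⟨hS.torsion_eq_zero_of_same_eigenbundle hDB, fun x X Y hX hY hBX hBY ↦ ?_,
      hS.torsion_eq_zero_iff hDK hDB⟩⟩
  refine ⟨hS.torsion_mixed hDK hDB hX hY hBX hBY, ?_⟩
  rw [hS.torsion_mixed hDK hDB hX hY hBX hBY, S.πPlus_apply, S.πMinus_apply]
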